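/- Setting. Let $\mathcal E$ be a Banach space endowed with a semi-norm $\|\cdot\|$ (measurable with respect to the $\sigma$-algebra of $\mathcal E$), let $\chi\in\mathcal E$, and let $(\mathcal X,Y)$ be a random pair with values in $\mathcal E\times\mathbb R$ such that $Y=r(\mathcal X)+\varepsilon$ with $E(\varepsilon\mid\mathcal X)=0$ and $E(\varepsilon^2\mid\mathcal X)=\sigma_\varepsilon^2(\mathcal X)<\infty$. Let $(\mathcal X_i,Y_i)_{i\ge1}$ be independent copies of $(\mathcal X,Y)$, let $F(t)=P(\|\chi-\mathcal X\|\le t)$, let $(h_n)_{n\ge1}$ be positive bandwidths, let $K$ be a kernel, let $\ell\in[0,1]$, and put $$r_n^{[\ell]}(\chi)=\frac{\sum_{i=1}^n\frac{Y_i}{F(h_i)^\ell}K\left(\frac{\|\chi-\mathcal X_i\|}{h_i}\right)}{\sum_{i=1}^n\frac{1}{F(h_i)^\ell}K\left(\frac{\|\chi-\mathcal X_i\|}{h_i}\right)}$$ (with the value $0$ if the denominator vanishes). Assumptions. (H1) $r$ and $\sigma_\varepsilon^2$ are continuous, for the semi-norm, on a neighborhood of $\chi$; $F(0)=0$; and (a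 version of) the function $\varphi(t)=E[r(\mathcal X)-r(\chi)\mid\|\mathcal X-\chi\|=t]$, $t\ge0$, is differentiable at $t=0$. (H2) $K$ is nonnegative and bounded, vanishes outside $[0,1]$, satisfies $\inf_{t\in[0,1]}K(t)>0$, and is absolutely continuous on $[0,1]$, so that $K'$ exists almost everywhere on $(0,1)$. (H3) For every $s\in[0,1]$, $F(hs)/F(h)\to\tau_0(s)<\infty$ as $h\to0^+$. (H4) $h_n\to0$ and $nF(h_n)\to\infty$; moreover $\frac1n\sum_{i=1}^n\frac{h_i}{h_n}\left[\frac{F(h_i)}{F(h_n)}\right]^{1-\ell}\to\alpha_{[\ell]}<\infty$, and, for every real $q\le2$, $\frac1n\sum_{i=1}^n\left[\frac{F(h_i)}{F(h_n)}\right]^{q}\to\beta_{[q]}<\infty$, as $n\to\infty$. (H5) There are $\lambda,\mu>0$ with $E[\exp(\lambda|Y|^\mu)]<\infty$. (H7) For every $\delta>0$, $(\ln n)^\delta/\sqrt{nF(h_n)}\to0$ as $n\to\infty$. Put $$M_0=K(1)-\int_0^1(sK(s))'\tau_0(s)\,ds,\quad M_1=K(1)-\int_0^1K'(s)\tau_0(s)\,ds,\quad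 M_2=K^2(1)-\int_0^1(K^2(s))'\tau_0(s)\,ds.$$ Theorem. Assume (H1)–(H5) and (H7), and that $h_n\sqrt{nF(h_n)}\to c$ as $n\to\infty$ for some $c\ge0$. Then $\beta_{[1-\ell]}>0$, $M_1>0$, and $$\sqrt{nF(h_n)}\left(r_n^{[\ell]}(\chi)-r(\chi)\right)\xrightarrow{\ \mathcal D\ }\mathcal N\left(c\,\frac{\alpha_{[\ell]}}{\beta_{[1-\ell]}}\frac{M_0}{M_1}\varphi'(0),\ \frac{\beta_{[1-2\ell]}}{\beta_{[1-\ell]}^2}\frac{M_2}{M_1^2}\sigma_\varepsilon^2(\chi)\right),$$ where the variance is nonnegative and $\mathcal N(m,0)$ denotes the unit mass at $m$. -/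

import Mathlib

open MeasureTheory ProbabilityTheory Filter Topology
open scoped BigOperators

noncomputable section

/-- The (small ball) distribution function `F(t) = P(‖χ - X‖ ≤ t)` of the real random variable
`‖χ - X‖`, where the semi-norm of the space is `p`. -/
def smallBall {Ω E : Type*} [MeasurableSpace Ω] [AddCommGroup E] [Module ℝ E]
    (P : Measure Ω) (p : Seminorm ℝ E) (χ : E) (X : Ω → E) (t : ℝ) : ℝ :=
  cdf (P.map (fun ω => p (χ - X ω))) t

/-- The recursive kernel regression estimator `r_n^{[ℓ]}(χ)` built on `(X_i, Y_i)`, `1 ≤ i ≤ n`. -/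
def recursiveEstimator {Ω E : Type*} [AddCommGroup E] [Module ℝ E]
    (p : Seminorm ℝ E) (χ : E) (K : ℝ → ℝ) (h : ℕ → ℝ) (F : ℝ → ℝ) (ℓ : ℝ)
    (Xs : ℕ → Ω → E) (Ys : ℕ → Ω → ℝ) (n : ℕ) (ω : Ω) : ℝ :=
  (∑ i ∈ Finset.Icc 1 n, Ys i ω / F (h i) ^ ℓ * K (p (χ - Xs i ω) / h i)) /
    (∑ i ∈ Finset.Icc 1 n, 1 / F (h i) ^ ℓ * K (p (χ - Xs i ω) / h i))

/-- Continuity at `x` of a real function on `E`, with respect to the semi-norm `p`. -/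
def SeminormContinuousAt {E : Type*} [AddCommGroup E] [Module ℝ E]
    (p : Seminorm ℝ E) (f : E → ℝ) (x : E) : Prop :=
  ∀ ε : ℝ, 0 < ε → ∃ δ : ℝ, 0 < δ ∧ ∀ y : E, p (y - x) < δ → |f y - f x| < ε

/-- Continuity on a neighborhood (a semi-norm ball) of `χ`. -/
def SeminormContinuousNear {E : Type*} [AddCommGroup E] [Module ℝ E]
    (p : Seminorm ℝ E) (f : E → ℝ) (χ : E) : Prop :=
  ∃ ρ : ℝ, 0 < ρ ∧ ∀ x : E, p (x - χ) < ρ → SeminormContinuousAt p f x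

/-- The regression model `Y = r(X) + ε` with `E(ε | X) = 0` (that is, `E(Y | X) = r(X)`) and
`E(ε² | X) = σ²(X)`, where `ε = Y - r(X)`. -/
structure IsRegressionModel {Ω E : Type*} [MeasurableSpace Ω] [MeasurableSpace E]
    (P : Measure Ω) (X : Ω → E) (Y : Ω → ℝ) (r σsq : E → ℝ) : Prop where
  measurable_X : Measurable X
  measurable_Y : Measurable Y
  measurable_r : Measurable r
  measurable_σsq : Measurable σsq
  integrable_error : Integrable (fun ω => Y ω - r (X ω)) P
  integrable_error_sq : Integrable (fun ω => (Y ω - r (X ω)) ^ 2) P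
  condExp_error :
    P[fun ω => Y ω - r (X ω) | MeasurableSpace.comap X inferInstance] =ᵐ[P] 0
  condExp_error_sq :
    P[fun ω => (Y ω - r (X ω)) ^ 2 | MeasurableSpace.comap X inferInstance]
      =ᵐ[P] fun ω => σsq (X ω)

/-- `φ` is a version of the function `t ↦ E[r(X) - r(χ) | ‖X - χ‖ = t]`. -/
structure IsRadialBias {Ω E : Type*} [MeasurableSpace Ω] [AddCommGroup E] [Module ℝ E]
    (P : Measure Ω) (p : Seminorm ℝ E) (χ : E) (X : Ω → E) (r : E → ℝ) (φ : ℝ → ℝ) : Prop where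
  measurable : Measurable φ
  condExp_eq :
    P[fun ω => r (X ω) - r χ | MeasurableSpace.comap (fun ω => p (X ω - χ)) inferInstance]
      =ᵐ[P] fun ω => φ (p (X ω - χ))

/-- A nonnegative bounded kernel with support in `[0,1]`, bounded away from zero on `[0,1]`.
Absolute continuity on `[0,1]` is what gives the derivative `K'` (which exists almost everywhere
in `(0,1)`) its meaning in the constants below. -/
structure IsKernel (K : ℝ → ℝ) : Prop where
  nonneg : ∀ t, 0 ≤ K t
  bounded : ∃ C : ℝ, ∀ t, K t ≤ C
  support : ∀ t, t ∉ Set.Icc (0 : ℝ) 1 → K t = 0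
  pos : ∃ k : ℝ, 0 < k ∧ ∀ t ∈ Set.Icc (0 : ℝ) 1, k ≤ K t
  absolutelyContinuous : AbsolutelyContinuousOnInterval K 0 1

/-- `M₀ = K(1) - ∫₀¹ (s K(s))' τ₀(s) ds`. -/
def kernelM0 (K τ₀ : ℝ → ℝ) : ℝ :=
  K 1 - ∫ s in (0 : ℝ)..1, deriv (fun u => u * K u) s * τ₀ s

/-- `M₁ = K(1) - ∫₀¹ K'(s) τ₀(s) ds`. -/
def kernelM1 (K τ₀ : ℝ → ℝ) : ℝ :=
  K 1 - ∫ s in (0 : ℝ)..1, deriv K s * τ₀ s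

/-- `M₂ = K²(1) - ∫₀¹ (K²(s))' τ₀(s) ds`. -/
def kernelM2 (K τ₀ : ℝ → ℝ) : ℝ :=
  K 1 ^ 2 - ∫ s in (0 : ℝ)..1, deriv (fun u => K u ^ 2) s * τ₀ s

/-- The weighted mean `A_{n,ℓ} = (1/n) ∑_{i=1}^n (h_i/h_n) (F(h_i)/F(h_n))^{1-ℓ}`. -/
def bandwidthA (F : ℝ → ℝ) (h : ℕ → ℝ) (ℓ : ℝ) (n : ℕ) : ℝ :=
  (1 / (n : ℝ)) * ∑ i ∈ Finset.Icc 1 n, h i / h n * (F (h i) / F (h n)) ^ (1 - ℓ)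

/-- The mean `B_{n,q} = (1/n) ∑_{i=1}^n (F(h_i)/F(h_n))^q`. -/
def bandwidthB (F : ℝ → ℝ) (h : ℕ → ℝ) (q : ℝ) (n : ℕ) : ℝ :=
  (1 / (n : ℝ)) * ∑ i ∈ Finset.Icc 1 n, (F (h i) / F (h n)) ^ q

end

/-!
Multiplied by `√(n F(h n))`, the error of the estimator at `χ` is the quotient of
`S n = (√(n F(h n)))⁻¹ ∑ (F(h i) / F(h n)) ^ (-ℓ) U_i K(Z_i / h i)` by
`D n = (n F(h n))⁻¹ ∑ (F(h i) / F(h n)) ^ (-ℓ) K(Z_i / h i)`, where `Z_i = ‖χ - X_i‖` and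
`U_i = Y_i - r(χ)`. The numerator is asymptotically normal, the denominator converges in probability
to a positive constant, and Slutsky's theorem gives the limit of the quotient; the event where the
denominator vanishes is asymptotically negligible.

The moments of the summands come from small ball asymptotics. For `G` absolutely continuous on
`[0, 1]` and zero elsewhere, integration by parts gives
`E G(Z / h) = G(1) F(h) - ∫ G'(s) F(h s) ds`, so that dominated convergence turns `E G(Z / h) / F(h)`
into `M₀`, `M₁`, `M₂` for `G(u) = u K(u)`, `K(u)`, `K(u) ^ 2` (`tendsto_integral_kernel_div`).
Localization at `χ` then replaces `σ²(X)` by `σ²(χ)`, removes the squared bias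
(`tendsto_integral_response_sq_mul_kernel_div`), and replaces `φ(Z)` by `φ' Z`, since `φ(0) = 0` by
continuity of `r` (`tendsto_integral_response_mul_kernel_div`). Summation over the sample is a
Toeplitz argument (`tendsto_sum_mul_of_tendsto`), in which the bandwidth means appear as the total
weights.

The numerator is treated by Lindeberg's theorem for triangular arrays that are not centred
(`tendstoInDistribution_sum_of_lindeberg`), proved from characteristic functions and Lévy's
continuity theorem. Lindeberg's condition is checked by truncating the responses at a power of
`ln n`: the exponential moment leaves a second moment of order `1 / n` above that level, and below
it a summand gains a factor which is a power of `ln n` over `√(n F(h n))`. The denominator is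
treated by Chebyshev's inequality.
-/

/-! ### The central limit theorem for triangular arrays -/

lemma norm_prod_sub_prod_le_sum {ι : Type*} (s : Finset ι) (a b : ι → ℂ)
    (ha : ∀ i ∈ s, ‖a i‖ ≤ 1) (hb : ∀ i ∈ s, ‖b i‖ ≤ 1) :
    ‖∏ i ∈ s, a i - ∏ i ∈ s, b i‖ ≤ ∑ i ∈ s, ‖a i - b i‖ := by
  classical
  induction s using Finset.induction_on with
  | empty => simp
  | insert j s hj ih =>
    simp only [Finset.mem_insert, forall_eq_or_imp] at ha hb
    rw [Finset.prod_insert hj, Finset.prod_insert hj, Finset.sum_insert hj]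
    have hprod : ‖∏ i ∈ s, a i‖ ≤ 1 := by
      rw [norm_prod]
      exact Finset.prod_le_one (fun i _ => norm_nonneg _) ha.2
    calc ‖a j * ∏ i ∈ s, a i - b j * ∏ i ∈ s, b i‖
        = ‖(a j - b j) * ∏ i ∈ s, a i + b j * (∏ i ∈ s, a i - ∏ i ∈ s, b i)‖ := by
          congr 1; ring
      _ ≤ ‖a j - b j‖ * ‖∏ i ∈ s, a i‖ + ‖b j‖ * ‖∏ i ∈ s, a i - ∏ i ∈ s, b i‖ := by
          simpa only [norm_mul] using norm_add_le ((a j - b j) * ∏ i ∈ s, a i)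
            (b j * (∏ i ∈ s, a i - ∏ i ∈ s, b i))
      _ ≤ ‖a j - b j‖ * 1 + 1 * ∑ i ∈ s, ‖a i - b i‖ := by
          gcongr
          · exact hb.1
          · exact ih ha.2 hb.2
      _ = _ := by ring

/-- A crude second order bound, valid on the whole left half-plane. -/
lemma Complex.norm_exp_sub_one_sub_id_le_of_re_nonpos {z : ℂ} (hz : z.re ≤ 0) :
    ‖Complex.exp z - 1 - z‖ ≤ 3 * ‖z‖ ^ 2 := by
  rcases le_total ‖z‖ 1 with h | h
  · have := Complex.norm_exp_sub_one_sub_id_le h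
    nlinarith [sq_nonneg ‖z‖]
  · have h1 : ‖Complex.exp z‖ ≤ 1 := by
      rw [Complex.norm_exp]; exact Real.exp_le_one_iff.2 hz
    have h2 : ‖Complex.exp z - 1 - z‖ ≤ ‖Complex.exp z‖ + ‖(1 : ℂ)‖ + ‖z‖ :=
      (norm_sub_le _ _).trans (by gcongr; exact norm_sub_le _ _)
    rw [norm_one] at h2
    nlinarith

/-- The second order Taylor remainder of `x ↦ exp (i x)`, bounded by a cubic or a quadratic term
according to whether the actual size `|y|` of the variable is below a threshold `ε` or not. -/
lemma norm_exp_mul_I_taylor_two_le (t y : ℝ) {ε : ℝ} (hε : 0 < ε) :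
    ‖Complex.exp (t * y * Complex.I) - (1 + t * y * Complex.I - (t * y) ^ 2 / 2)‖ ≤
      4 * |t| ^ 3 * ε * y ^ 2 + 4 * t ^ 2 * Set.indicator {x : ℝ | ε < |x|} (fun x => x ^ 2) y := by
  set x : ℝ := t * y with hx
  have hcast : (t : ℂ) * y = (x : ℂ) := by rw [hx]; push_cast; ring
  rw [hcast]
  have hnorm : ‖(x : ℂ) * Complex.I‖ = |x| := by simp
  have hcube : ‖Complex.exp (x * Complex.I) - (1 + x * Complex.I - (x : ℂ) ^ 2 / 2)‖
      ≤ 4 * |x| ^ 3 ∧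
      ‖Complex.exp (x * Complex.I) - (1 + x * Complex.I - (x : ℂ) ^ 2 / 2)‖ ≤ 4 * |x| ^ 2 := by
    rcases le_total |x| 1 with h | h
    · have hb := Complex.exp_bound (x := (x : ℂ) * Complex.I) (by rwa [hnorm])
        (n := 3) (by norm_num)
      have hsum : ∑ m ∈ Finset.range 3, ((x : ℂ) * Complex.I) ^ m / (m.factorial : ℂ)
          = 1 + x * Complex.I - (x : ℂ) ^ 2 / 2 := by
        simp [Finset.sum_range_succ, Nat.factorial, mul_pow]; ring
      rw [hsum, hnorm] at hb
      norm_num [Nat.factorial] at hb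
      have h0 := abs_nonneg x
      have h3 : |x| ^ 3 ≤ |x| ^ 2 := by nlinarith [sq_nonneg |x|]
      have h4 : 0 ≤ |x| ^ 3 := by positivity
      constructor <;> linarith
    · have h1 : ‖Complex.exp (x * Complex.I)‖ = 1 := Complex.norm_exp_ofReal_mul_I x
      have h2 : ‖(1 : ℂ) + x * Complex.I - (x : ℂ) ^ 2 / 2‖ ≤ 1 + |x| + |x| ^ 2 / 2 := by
        refine (norm_sub_le _ _).trans ?_
        refine add_le_add ((norm_add_le _ _).trans ?_) ?_
        · rw [hnorm, norm_one]
        · simp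
      have h5 := norm_sub_le (Complex.exp (x * Complex.I))
        (1 + x * Complex.I - (x : ℂ) ^ 2 / 2)
      have h3 : |x| ^ 2 ≤ |x| ^ 3 := by nlinarith [sq_nonneg |x|]
      have h6 : |x| ≤ |x| ^ 2 := by nlinarith
      constructor <;> linarith
  by_cases hy : ε < |y|
  · rw [Set.indicator_of_mem (by exact hy)]
    refine hcube.2.trans ?_
    have : |x| ^ 2 = t ^ 2 * y ^ 2 := by rw [sq_abs, hx]; ring
    rw [this]
    have : 0 ≤ 4 * |t| ^ 3 * ε * y ^ 2 := by positivity
    linarith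
  · rw [Set.indicator_of_notMem (by exact hy)]
    refine hcube.1.trans ?_
    have : |x| ^ 3 = |t| ^ 3 * |y| * y ^ 2 := by
      rw [hx, abs_mul, ← sq_abs y]; ring
    rw [this]
    have h1 : |t| ^ 3 * |y| * y ^ 2 ≤ |t| ^ 3 * ε * y ^ 2 := by
      gcongr; exact not_lt.1 hy
    linarith

/-- A nonnegative function that is, for every `ε > 0`, eventually at most `ε` times a convergent
function plus a null function (which may depend on `ε`) tends to zero. -/
lemma tendsto_zero_of_forall_le_mul_add {γ : Type*} {l : Filter γ} {x A : γ → ℝ} {a : ℝ}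
    (hx : ∀ᶠ n in l, 0 ≤ x n) (hA : Tendsto A l (𝓝 a))
    (H : ∀ ε > 0, ∃ g : γ → ℝ, Tendsto g l (𝓝 0) ∧ ∀ᶠ n in l, x n ≤ ε * A n + g n) :
    Tendsto x l (𝓝 0) := by
  rw [Metric.tendsto_nhds]
  intro η hη
  have hpos : 0 < |a| + 2 := by positivity
  obtain ⟨g, hg, hle⟩ := H (η / (|a| + 2) / 2) (by positivity)
  have h1 : ∀ᶠ n in l, A n < |a| + 1 := hA.eventually_lt_const (by
    have := le_abs_self a; linarith)
  have h2 : ∀ᶠ n in l, g n < η / 2 := hg.eventually_lt_const (by positivity)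
  filter_upwards [h1, h2, hle, hx] with n h1 h2 h3 h4
  rw [Real.dist_eq, sub_zero, abs_of_nonneg h4]
  have h5 : η / (|a| + 2) / 2 * A n ≤ η / (|a| + 2) / 2 * (|a| + 2) := by
    gcongr; linarith
  have h6 : η / (|a| + 2) / 2 * (|a| + 2) = η / 2 := by field_simp
  linarith

lemma integrable_indicator_sq {Ω : Type*} [MeasurableSpace Ω] {P : Measure Ω}
    {ξ : Ω → ℝ} (hξ : MemLp ξ 2 P) (ε : ℝ) :
    Integrable (fun ω => Set.indicator {x : ℝ | ε < |x|} (fun x => x ^ 2) (ξ ω)) P := by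
  have hmeas : Measurable (Set.indicator {x : ℝ | ε < |x|} (fun x : ℝ => x ^ 2)) :=
    (measurable_id.pow_const 2).indicator (measurableSet_lt measurable_const measurable_id.abs)
  refine hξ.integrable_sq.mono (hmeas.comp_aemeasurable hξ.1.aemeasurable).aestronglyMeasurable
    (ae_of_all _ fun ω => ?_)
  exact norm_indicator_le_norm_self (fun x : ℝ => x ^ 2) (ξ ω)

section Lindeberg

variable {Ω ι : Type*} [MeasurableSpace Ω] {P : Measure Ω} [IsProbabilityMeasure P]

/-- A square integrable variable has, up to a Lindeberg type error, a characteristic function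
equal to its second order expansion. -/
lemma norm_charFun_map_sub_le {ξ : Ω → ℝ} (hξ : MemLp ξ 2 P) (t : ℝ) {ε : ℝ} (hε : 0 < ε) :
    ‖charFun (P.map ξ) t -
      (1 + ((t * ∫ ω, ξ ω ∂P : ℝ) * Complex.I - (t ^ 2 * (∫ ω, ξ ω ^ 2 ∂P) / 2 : ℝ)))‖ ≤
      4 * |t| ^ 3 * ε * ∫ ω, ξ ω ^ 2 ∂P +
        4 * t ^ 2 * ∫ ω, Set.indicator {x : ℝ | ε < |x|} (fun x => x ^ 2) (ξ ω) ∂P := by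
  have hint : Integrable ξ P := hξ.integrable (by norm_num)
  have hsq : Integrable (fun ω => ξ ω ^ 2) P := hξ.integrable_sq
  have hmeas : AEMeasurable ξ P := hξ.1.aemeasurable
  have hexp : Integrable (fun ω => Complex.exp (t * ξ ω * Complex.I)) P := by
    refine Integrable.of_bound (C := 1) ?_ (ae_of_all _ fun ω => ?_)
    · exact (Complex.measurable_exp.comp_aemeasurable (by fun_prop)).aestronglyMeasurable
    · have := Complex.norm_exp_ofReal_mul_I (t * ξ ω)
      push_cast at this
      exact this.le
  have hpoly : Integrable
      (fun ω => (1 : ℂ) + t * ξ ω * Complex.I - (t * ξ ω : ℂ) ^ 2 / 2) P := by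
    refine ((integrable_const _).add ((hint.ofReal.const_mul _).mul_const _)).sub ?_
    have : (fun ω => (t * ξ ω : ℂ) ^ 2 / 2) = fun ω => ((t : ℂ) ^ 2 / 2) * ((ξ ω ^ 2 : ℝ) : ℂ) := by
      ext ω; push_cast; ring
    rw [this]
    exact hsq.ofReal.const_mul _
  have hval : ∫ ω, ((1 : ℂ) + t * ξ ω * Complex.I - (t * ξ ω : ℂ) ^ 2 / 2) ∂P =
      1 + ((t * ∫ ω, ξ ω ∂P : ℝ) * Complex.I - (t ^ 2 * (∫ ω, ξ ω ^ 2 ∂P) / 2 : ℝ)) := by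
    have : (fun ω => (1 : ℂ) + t * ξ ω * Complex.I - (t * ξ ω : ℂ) ^ 2 / 2) =
        fun ω => (1 : ℂ) + t * Complex.I * (ξ ω : ℂ) - ((t : ℂ) ^ 2 / 2) * ((ξ ω ^ 2 : ℝ) : ℂ) := by
      ext ω; push_cast; ring
    rw [this, integral_sub ((integrable_const _).add (hint.ofReal.const_mul _))
      (hsq.ofReal.const_mul _), integral_add (integrable_const _) (hint.ofReal.const_mul _),
      integral_const_mul, integral_const_mul, integral_complex_ofReal, integral_complex_ofReal]
    simp
    ring
  rw [charFun_apply_real, integral_map hmeas (by fun_prop), ← hval, ← integral_sub hexp hpoly,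
    ← integral_const_mul, ← integral_const_mul,
    ← integral_add (hsq.const_mul _) ((integrable_indicator_sq hξ ε).const_mul _)]
  exact norm_integral_le_of_norm_le ((hsq.const_mul _).add
    ((integrable_indicator_sq hξ ε).const_mul _))
    (ae_of_all _ fun ω => norm_exp_mul_I_taylor_two_le t (ξ ω) hε)

/-- **Lindeberg's central limit theorem** for a triangular array that need not be centred: the
first moments converge in sum, the squares of the first moments are negligible, the second moments
converge in sum, and Lindeberg's condition holds. -/
theorem tendstoInDistribution_sum_of_lindeberg {ξ : ℕ → ι → Ω → ℝ} (s : ℕ → Finset ι)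
    (hindep : ∀ n, iIndepFun (ξ n) P) (hL2 : ∀ n i, MemLp (ξ n i) 2 P) {m v : ℝ}
    (hm : Tendsto (fun n => ∑ i ∈ s n, ∫ ω, ξ n i ω ∂P) atTop (𝓝 m))
    (hm2 : Tendsto (fun n => ∑ i ∈ s n, (∫ ω, ξ n i ω ∂P) ^ 2) atTop (𝓝 0))
    (hv : Tendsto (fun n => ∑ i ∈ s n, ∫ ω, ξ n i ω ^ 2 ∂P) atTop (𝓝 v))
    (hlin : ∀ ε > 0, Tendsto (fun n => ∑ i ∈ s n,
      ∫ ω, Set.indicator {x : ℝ | ε < |x|} (fun x => x ^ 2) (ξ n i ω) ∂P) atTop (𝓝 0)) :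
    TendstoInDistribution (fun n ω => ∑ i ∈ s n, ξ n i ω) atTop (id : ℝ → ℝ) (fun _ => P)
      (gaussianReal m v.toNNReal) := by
  have hae : ∀ n i, AEMeasurable (ξ n i) P := fun n i => (hL2 n i).1.aemeasurable
  refine ⟨fun n => Finset.aemeasurable_fun_sum _ fun i _ => hae n i, aemeasurable_id, ?_⟩
  refine ProbabilityMeasure.tendsto_iff_tendsto_charFun.2 fun t => ?_
  set μ : ℕ → ι → ℝ := fun n i => ∫ ω, ξ n i ω ∂P with hμ
  set S : ℕ → ι → ℝ := fun n i => ∫ ω, ξ n i ω ^ 2 ∂P with hS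
  set Λ : ℝ → ℕ → ι → ℝ := fun ε n i =>
    ∫ ω, Set.indicator {x : ℝ | ε < |x|} (fun x => x ^ 2) (ξ n i ω) ∂P with hΛ
  have hS0 : ∀ n i, 0 ≤ S n i := fun n i => integral_nonneg fun ω => sq_nonneg _
  have hΛ0 : ∀ ε n i, 0 ≤ Λ ε n i := fun ε n i =>
    integral_nonneg fun ω => Set.indicator_nonneg (fun x _ => sq_nonneg x) _
  have hv0 : 0 ≤ v := ge_of_tendsto' hv fun n => Finset.sum_nonneg fun i _ => hS0 n i
  -- the individual second moments are uniformly negligible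
  have hSε : ∀ ε > 0, ∀ n, ∀ i, S n i ≤ ε ^ 2 + Λ ε n i := by
    intro ε hε n i
    have hint := integrable_indicator_sq (hL2 n i) ε
    have : S n i ≤ ∫ ω, (ε ^ 2 + Set.indicator {x : ℝ | ε < |x|} (fun x => x ^ 2) (ξ n i ω)) ∂P := by
      refine integral_mono (hL2 n i).integrable_sq ((integrable_const _).add hint) fun ω => ?_
      by_cases hy : ε < |ξ n i ω|
      · simp only [Set.indicator_of_mem (show ξ n i ω ∈ {x : ℝ | ε < |x|} from hy)]
        nlinarith [sq_nonneg ε]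
      · simp only [Set.indicator_of_notMem (show ξ n i ω ∉ {x : ℝ | ε < |x|} from hy)]
        rw [add_zero]
        exact sq_le_sq' (by linarith [neg_abs_le (ξ n i ω)])
          ((le_abs_self _).trans (not_lt.1 hy))
    rw [integral_add (integrable_const _) hint] at this
    simpa using this
  have hS2 : Tendsto (fun n => ∑ i ∈ s n, S n i ^ 2) atTop (𝓝 0) := by
    refine tendsto_zero_of_forall_le_mul_add
      (Eventually.of_forall fun n => Finset.sum_nonneg fun i _ => sq_nonneg _) hv fun ε hε => ?_
    have hrε : 0 < √ε := Real.sqrt_pos.2 hε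
    refine ⟨fun n => (∑ i ∈ s n, Λ (√ε) n i) * ∑ i ∈ s n, S n i, ?_, Eventually.of_forall fun n => ?_⟩
    · simpa using (hlin _ hrε).mul hv
    · have hle : ∀ i ∈ s n, S n i ≤ ε + ∑ j ∈ s n, Λ (√ε) n j := by
        intro i hi
        have h1 := hSε _ hrε n i
        rw [Real.sq_sqrt hε.le] at h1
        have h2 := Finset.single_le_sum (f := fun j => Λ (√ε) n j) (fun j _ => hΛ0 _ n j) hi
        linarith
      calc ∑ i ∈ s n, S n i ^ 2 ≤ ∑ i ∈ s n, (ε + ∑ j ∈ s n, Λ (√ε) n j) * S n i := by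
            refine Finset.sum_le_sum fun i hi => ?_
            rw [sq]
            exact mul_le_mul_of_nonneg_right (hle i hi) (hS0 n i)
        _ = _ := by rw [← Finset.mul_sum]; ring
  -- the logarithm of the approximating product
  set z : ℕ → ι → ℂ := fun n i => ((t * μ n i : ℝ) : ℂ) * Complex.I - ((t ^ 2 * S n i / 2 : ℝ) : ℂ)
    with hz
  have hzre : ∀ n i, (z n i).re ≤ 0 := by
    intro n i
    have : (z n i).re = -(t ^ 2 * S n i / 2) := by
      simp only [hz, Complex.sub_re, Complex.mul_re, Complex.ofReal_re, Complex.ofReal_im,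
        Complex.I_re, Complex.I_im]
      ring
    rw [this]
    have := hS0 n i
    have : 0 ≤ t ^ 2 * S n i / 2 := by positivity
    linarith
  have hznorm : ∀ n i, ‖z n i‖ ^ 2 = t ^ 2 * μ n i ^ 2 + t ^ 4 / 4 * S n i ^ 2 := by
    intro n i
    rw [Complex.sq_norm, Complex.normSq_apply]
    simp only [hz, Complex.sub_re, Complex.mul_re, Complex.ofReal_re, Complex.ofReal_im,
      Complex.I_re, Complex.I_im, Complex.sub_im, Complex.mul_im]
    ring
  have hchar : ∀ n, charFun (P.map fun ω => ∑ i ∈ s n, ξ n i ω) t =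
      ∏ i ∈ s n, charFun (P.map (ξ n i)) t := by
    intro n
    have := iIndepFun.charFun_map_fun_finsetSum_eq_prod (s := s n) (fun i _ => hae n i)
      ((hindep n).restrict (s n))
    rw [this, Finset.prod_apply]
  have hbound : ∀ ε > 0, ∀ n, ‖charFun (P.map fun ω => ∑ i ∈ s n, ξ n i ω) t -
      Complex.exp (∑ i ∈ s n, z n i)‖ ≤ ε * ((4 * |t| ^ 3) * ∑ i ∈ s n, S n i) +
        (4 * t ^ 2 * ∑ i ∈ s n, Λ ε n i +
          3 * (t ^ 2 * ∑ i ∈ s n, μ n i ^ 2 + t ^ 4 / 4 * ∑ i ∈ s n, S n i ^ 2)) := by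
    intro ε hε n
    rw [hchar, Complex.exp_sum]
    refine (norm_prod_sub_prod_le_sum _ _ _ (fun i _ => ?_) fun i _ => ?_).trans ?_
    · have := Measure.isProbabilityMeasure_map (hae n i)
      exact norm_charFun_le_one t
    · rw [Complex.norm_exp]
      exact Real.exp_le_one_iff.2 (hzre n i)
    · calc ∑ i ∈ s n, ‖charFun (P.map (ξ n i)) t - Complex.exp (z n i)‖
          ≤ ∑ i ∈ s n, ((4 * |t| ^ 3 * ε * S n i + 4 * t ^ 2 * Λ ε n i) +
              3 * (t ^ 2 * μ n i ^ 2 + t ^ 4 / 4 * S n i ^ 2)) := by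
            refine Finset.sum_le_sum fun i _ => ?_
            rw [← hznorm]
            have h1 := norm_charFun_map_sub_le (hL2 n i) t hε
            have h2 := Complex.norm_exp_sub_one_sub_id_le_of_re_nonpos (hzre n i)
            have h3 : charFun (P.map (ξ n i)) t - Complex.exp (z n i) =
                (charFun (P.map (ξ n i)) t - (1 + z n i)) -
                  (Complex.exp (z n i) - 1 - z n i) := by ring
            rw [h3]
            exact (norm_sub_le _ _).trans (add_le_add h1 h2)
        _ = _ := by
            simp only [Finset.sum_add_distrib, ← Finset.mul_sum]
            ring
  have hdiff : Tendsto (fun n => charFun (P.map fun ω => ∑ i ∈ s n, ξ n i ω) t -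
      Complex.exp (∑ i ∈ s n, z n i)) atTop (𝓝 0) := by
    rw [tendsto_zero_iff_norm_tendsto_zero]
    refine tendsto_zero_of_forall_le_mul_add (Eventually.of_forall fun n => norm_nonneg _)
      (hv.const_mul (4 * |t| ^ 3)) fun ε hε => ⟨_, ?_, Eventually.of_forall (hbound ε hε)⟩
    simpa using ((hlin ε hε).const_mul (4 * t ^ 2)).add
      (((hm2.const_mul (t ^ 2)).add (hS2.const_mul (t ^ 4 / 4))).const_mul 3)
  have hexp : Tendsto (fun n => Complex.exp (∑ i ∈ s n, z n i)) atTop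
      (𝓝 (charFun (gaussianReal m v.toNNReal) t)) := by
    rw [charFun_gaussianReal]
    refine (Complex.continuous_exp.tendsto _).comp ?_
    have hsum : ∀ n, ∑ i ∈ s n, z n i = ((t * ∑ i ∈ s n, μ n i : ℝ) : ℂ) * Complex.I -
        ((t ^ 2 * (∑ i ∈ s n, S n i) / 2 : ℝ) : ℂ) := by
      intro n
      simp only [hz, Finset.sum_sub_distrib, ← Finset.sum_mul, ← Complex.ofReal_sum,
        ← Finset.mul_sum, ← Finset.sum_div]
    simp only [hsum]
    have hlim : (t : ℂ) * m * Complex.I - ((v.toNNReal : ℝ) : ℂ) * t ^ 2 / 2 =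
        ((t * m : ℝ) : ℂ) * Complex.I - ((t ^ 2 * v / 2 : ℝ) : ℂ) := by
      rw [Real.coe_toNNReal _ hv0]; push_cast; ring
    rw [hlim]
    exact (((Complex.continuous_ofReal.tendsto _).comp (hm.const_mul t)).mul_const _).sub
      ((Complex.continuous_ofReal.tendsto _).comp ((hv.const_mul (t ^ 2)).div_const 2))
  have := hdiff.add hexp
  simp only [sub_add_cancel, zero_add] at this
  simpa using this

end Lindeberg

/-! ### Kernel moments of a nonnegative variable -/

lemma measurable_of_continuousOn_Icc {G : ℝ → ℝ} (hG : ContinuousOn G (Set.Icc 0 1))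
    (hsupp : ∀ t, t ∉ Set.Icc (0 : ℝ) 1 → G t = 0) : Measurable G := by
  classical
  have : G = Set.piecewise (Set.Icc 0 1) G (fun _ => 0) := by
    ext t
    by_cases ht : t ∈ Set.Icc (0 : ℝ) 1
    · rw [Set.piecewise_eq_of_mem _ _ _ ht]
    · rw [Set.piecewise_eq_of_notMem _ _ _ ht, hsupp t ht]
  rw [this]
  exact hG.measurable_piecewise continuousOn_const measurableSet_Icc

/-- Integration by parts against the distribution of a nonnegative variable `Z`, for a function `G`
that is absolutely continuous on `[0, 1]` and vanishes elsewhere. -/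
lemma integral_kernel_div_eq {Ω : Type*} [MeasurableSpace Ω] {P : Measure Ω}
    [IsProbabilityMeasure P] {Z : Ω → ℝ} (hZ : Measurable Z) (hZ0 : ∀ ω, 0 ≤ Z ω) {G : ℝ → ℝ}
    (hG : AbsolutelyContinuousOnInterval G 0 1) (hsupp : ∀ t, t ∉ Set.Icc (0 : ℝ) 1 → G t = 0)
    {h : ℝ} (hh : 0 < h) :
    ∫ ω, G (Z ω / h) ∂P = G 1 * cdf (P.map Z) h -
      ∫ s in (0 : ℝ)..1, deriv G s * cdf (P.map Z) (h * s) := by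
  have := Measure.isProbabilityMeasure_map (μ := P) hZ.aemeasurable
  have hcdf : ∀ t, cdf (P.map Z) t = P.real {ω | Z ω ≤ t} := by
    intro t
    rw [cdf_eq_real, map_measureReal_apply hZ measurableSet_Iic]
    rfl
  have hint : IntegrableOn (deriv G) (Set.Ioc 0 1) :=
    (intervalIntegrable_iff_integrableOn_Ioc_of_le zero_le_one).1 hG.intervalIntegrable_deriv
  set A : Set (Ω × ℝ) := {q | Z q.1 ≤ h * q.2} with hA
  have hAm : MeasurableSet A :=
    measurableSet_le (hZ.comp measurable_fst) (measurable_snd.const_mul h)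
  set f : Ω → ℝ → ℝ := fun ω s => A.indicator (fun q => deriv G q.2) (ω, s) with hf
  have hfint : Integrable (Function.uncurry f) (P.prod (volume.restrict (Set.Ioc (0 : ℝ) 1))) := by
    have : Integrable (fun q : Ω × ℝ => deriv G q.2)
        (P.prod (volume.restrict (Set.Ioc (0 : ℝ) 1))) := Integrable.comp_snd hint P
    exact this.indicator hAm
  have hpoint : ∀ ω, G (Z ω / h) = Set.indicator {ω | Z ω ≤ h} (fun _ => G 1) ω -
      ∫ s in Set.Ioc (0 : ℝ) 1, f ω s := by
    intro ω
    have hu0 : 0 ≤ Z ω / h := div_nonneg (hZ0 ω) hh.le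
    have hfω : f ω = (Set.Ici (Z ω / h)).indicator (deriv G) := by
      ext s
      simp only [hf, Set.indicator, hA, Set.mem_ofPred_eq, Set.mem_Ici, div_le_iff₀' hh]
    rw [hfω, setIntegral_indicator measurableSet_Ici]
    by_cases hle : Z ω ≤ h
    · have hu1 : Z ω / h ≤ 1 := (div_le_one hh).2 hle
      have hset : (Set.Ioc (0 : ℝ) 1 ∩ Set.Ici (Z ω / h) : Set ℝ) =ᵐ[volume]
          Set.Ioc (Z ω / h) 1 := by
        have h1 : (Set.Ioc (0 : ℝ) 1 ∩ Set.Ici (Z ω / h) : Set ℝ) =ᵐ[volume]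
            (Set.Ioc (0 : ℝ) 1 ∩ Set.Ioi (Z ω / h) : Set ℝ) :=
          (ae_eq_refl _).inter Ioi_ae_eq_Ici.symm
        have h2 : (Set.Ioc (0 : ℝ) 1 ∩ Set.Ioi (Z ω / h) : Set ℝ) = Set.Ioc (Z ω / h) 1 := by
          ext s
          simp only [Set.mem_inter_iff, Set.mem_Ioc, Set.mem_Ioi]
          constructor
          · rintro ⟨⟨_, h2⟩, h3⟩; exact ⟨h3, h2⟩
          · rintro ⟨h3, h2⟩; exact ⟨⟨hu0.trans_lt h3, h2⟩, h3⟩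
        rwa [h2] at h1
      have hmono : AbsolutelyContinuousOnInterval G (Z ω / h) 1 := hG.mono (by
        rw [Set.uIcc_of_le hu1, Set.uIcc_of_le zero_le_one]
        exact Set.Icc_subset_Icc_left hu0)
      rw [setIntegral_congr_set hset, ← intervalIntegral.integral_of_le hu1,
        hmono.integral_deriv_eq_sub, Set.indicator_of_mem (by exact hle)]
      ring
    · have hset : (Set.Ioc (0 : ℝ) 1 ∩ Set.Ici (Z ω / h) : Set ℝ) = ∅ := by
        ext s
        simp only [Set.mem_inter_iff, Set.mem_Ioc, Set.mem_Ici, Set.mem_empty_iff_false, iff_false]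
        rintro ⟨⟨_, h2⟩, h3⟩
        exact hle ((div_le_one hh).1 (h3.trans h2))
      rw [hset, Set.indicator_of_notMem (by exact hle), hsupp]
      · simp
      · rintro ⟨_, h2⟩
        exact hle ((div_le_one hh).1 h2)
  have hmle : MeasurableSet {ω | Z ω ≤ h} := measurableSet_le hZ measurable_const
  have hfi : Integrable (fun ω => ∫ s in Set.Ioc (0 : ℝ) 1, f ω s) P := hfint.integral_prod_left
  simp only [hpoint]
  rw [integral_sub ((integrable_const _).indicator hmle) hfi,
    integral_indicator_const _ hmle, ← hcdf, smul_eq_mul, mul_comm, integral_integral_swap hfint,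
    intervalIntegral.integral_of_le zero_le_one]
  congr 1
  refine integral_congr_ae (ae_of_all _ fun s => ?_)
  have hfs : (fun ω => f ω s) = Set.indicator {ω | Z ω ≤ h * s} (fun _ => deriv G s) := by
    ext ω
    simp only [hf, Set.indicator, hA, Set.mem_ofPred_eq]
  simp only [hfs]
  rw [integral_indicator_const _ (measurableSet_le hZ measurable_const), ← hcdf, smul_eq_mul,
    mul_comm]

/-- Kernel moments over a small ball are, to the first order, proportional to the small ball
probability. -/
theorem tendsto_integral_kernel_div {Ω : Type*} [MeasurableSpace Ω] {P : Measure Ω}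
    [IsProbabilityMeasure P] {Z : Ω → ℝ} (hZ : Measurable Z) (hZ0 : ∀ ω, 0 ≤ Z ω) {G : ℝ → ℝ}
    (hG : AbsolutelyContinuousOnInterval G 0 1) (hsupp : ∀ t, t ∉ Set.Icc (0 : ℝ) 1 → G t = 0)
    (hpos : ∀ t, 0 < t → 0 < cdf (P.map Z) t) {τ₀ : ℝ → ℝ}
    (hτ : ∀ s ∈ Set.Icc (0 : ℝ) 1,
      Tendsto (fun t => cdf (P.map Z) (t * s) / cdf (P.map Z) t) (𝓝[>] 0) (𝓝 (τ₀ s))) :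
    Tendsto (fun h => (∫ ω, G (Z ω / h) ∂P) / cdf (P.map Z) h) (𝓝[>] 0)
      (𝓝 (G 1 - ∫ s in (0 : ℝ)..1, deriv G s * τ₀ s)) := by
  have hlim : Tendsto (fun h => G 1 - ∫ s in (0 : ℝ)..1,
      deriv G s * (cdf (P.map Z) (h * s) / cdf (P.map Z) h)) (𝓝[>] 0)
      (𝓝 (G 1 - ∫ s in (0 : ℝ)..1, deriv G s * τ₀ s)) := by
    refine tendsto_const_nhds.sub ?_
    refine intervalIntegral.tendsto_integral_filter_of_dominated_convergence (fun s => |deriv G s|)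
      ?_ ?_ hG.intervalIntegrable_deriv.abs ?_
    · refine Eventually.of_forall fun h => ?_
      have : Measurable fun s : ℝ => cdf (P.map Z) (h * s) / cdf (P.map Z) h :=
        ((monotone_cdf _).measurable.comp (measurable_id.const_mul h)).div_const _
      exact ((measurable_deriv G).mul this).aestronglyMeasurable
    · filter_upwards [self_mem_nhdsWithin] with h hh
      refine ae_of_all _ fun s hs => ?_
      rw [Set.uIoc_of_le zero_le_one] at hs
      have hh' : 0 < h := hh
      rw [norm_mul, Real.norm_eq_abs, Real.norm_eq_abs,
        abs_of_nonneg (div_nonneg (cdf_nonneg _ _) (cdf_nonneg _ _))]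
      refine mul_le_of_le_one_right (abs_nonneg _) ((div_le_one (hpos h hh)).2 ?_)
      exact monotone_cdf _ (mul_le_of_le_one_right hh'.le hs.2)
    · refine ae_of_all _ fun s hs => ?_
      rw [Set.uIoc_of_le zero_le_one] at hs
      exact (hτ s ⟨hs.1.le, hs.2⟩).const_mul _
  refine hlim.congr' ?_
  filter_upwards [self_mem_nhdsWithin] with h hh
  have hF := (hpos h hh).ne'
  rw [integral_kernel_div_eq hZ hZ0 hG hsupp hh, sub_div, mul_div_cancel_right₀ _ hF,
    ← intervalIntegral.integral_div]
  congr 2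
  ext s
  ring

/-! ### Weighted means -/

/-- **Toeplitz lemma**: weighted sums of a convergent sequence, with nonnegative weights whose sum
converges and each of which is negligible. -/
theorem tendsto_sum_mul_of_tendsto {w : ℕ → ℕ → ℝ} {x : ℕ → ℝ} {L a : ℝ}
    (hw : ∀ᶠ n in atTop, ∀ i ∈ Finset.range n, 0 ≤ w n i)
    (hL : Tendsto (fun n => ∑ i ∈ Finset.range n, w n i) atTop (𝓝 L))
    (hneg : ∀ i, Tendsto (fun n => w n i) atTop (𝓝 0)) (hx : Tendsto x atTop (𝓝 a)) :
    Tendsto (fun n => ∑ i ∈ Finset.range n, w n i * x i) atTop (𝓝 (L * a)) := by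
  have hmain : Tendsto (fun n => ∑ i ∈ Finset.range n, w n i * (x i - a)) atTop (𝓝 0) := by
    refine squeeze_zero_norm' (a := fun n => ∑ i ∈ Finset.range n, w n i * |x i - a|) ?_ ?_
    · filter_upwards [hw] with n hn
      refine (norm_sum_le _ _).trans (Finset.sum_le_sum fun i hi => ?_)
      rw [norm_mul, Real.norm_eq_abs, Real.norm_eq_abs, abs_of_nonneg (hn i hi)]
    refine tendsto_zero_of_forall_le_mul_add ?_ hL fun ε hε => ?_
    · filter_upwards [hw] with n hn
      exact Finset.sum_nonneg fun i hi => mul_nonneg (hn i hi) (abs_nonneg _)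
    obtain ⟨N, hN⟩ := Metric.tendsto_atTop.1 hx ε hε
    refine ⟨fun n => ∑ i ∈ Finset.range N, w n i * |x i - a|, ?_, ?_⟩
    · simpa using tendsto_finsetSum (Finset.range N) fun i _ => (hneg i).mul_const |x i - a|
    · filter_upwards [hw, eventually_ge_atTop N] with n hn hNn
      rw [← Finset.sum_sdiff (Finset.range_mono hNn), Finset.mul_sum]
      gcongr
      calc ∑ i ∈ Finset.range n \ Finset.range N, w n i * |x i - a|
          ≤ ∑ i ∈ Finset.range n \ Finset.range N, ε * w n i := by
            refine Finset.sum_le_sum fun i hi => ?_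
            rw [Finset.mem_sdiff, Finset.mem_range, Finset.mem_range, not_lt] at hi
            rw [mul_comm]
            refine mul_le_mul_of_nonneg_right ?_ (hn i (Finset.mem_range.2 hi.1))
            have := hN i hi.2
            rw [Real.dist_eq] at this
            exact this.le
        _ ≤ ∑ i ∈ Finset.range n, ε * w n i :=
            Finset.sum_le_sum_of_subset_of_nonneg Finset.sdiff_subset
              fun i hi _ => mul_nonneg hε.le (hn i hi)
  have := hmain.add (hL.mul_const a)
  rw [zero_add] at this
  refine this.congr fun n => ?_
  rw [Finset.sum_mul, ← Finset.sum_add_distrib]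
  exact Finset.sum_congr rfl fun i _ => by ring

/-! ### Bandwidth means -/

lemma sum_Icc_one_eq_sum_range (f : ℕ → ℝ) (n : ℕ) :
    ∑ i ∈ Finset.Icc 1 n, f i = ∑ i ∈ Finset.range n, f (i + 1) := by
  induction n with
  | zero => simp
  | succ k ih => rw [Finset.sum_Icc_succ_top (by omega), ih, Finset.sum_range_succ]

lemma bandwidthB_eq_sum_range (F : ℝ → ℝ) (h : ℕ → ℝ) (q : ℝ) (n : ℕ) :
    bandwidthB F h q n = ∑ i ∈ Finset.range n, 1 / (n : ℝ) * (F (h (i + 1)) / F (h n)) ^ q := by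
  rw [bandwidthB, sum_Icc_one_eq_sum_range, Finset.mul_sum]

lemma bandwidthA_eq_sum_range (F : ℝ → ℝ) (h : ℕ → ℝ) (ℓ : ℝ) (n : ℕ) :
    bandwidthA F h ℓ n = ∑ i ∈ Finset.range n,
      1 / (n : ℝ) * (h (i + 1) / h n * (F (h (i + 1)) / F (h n)) ^ (1 - ℓ)) := by
  rw [bandwidthA, sum_Icc_one_eq_sum_range, Finset.mul_sum]

/-- Each weight in a bandwidth mean of order at most `1` is negligible: `F ≤ 1` gives
`F(h n) ^ q ≥ F(h n)`, and `n F(h n)` tends to infinity. -/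
lemma tendsto_weight_zero {F : ℝ → ℝ} {h : ℕ → ℝ} (hpos : ∀ n, 1 ≤ n → 0 < F (h n))
    (hle : ∀ t, F t ≤ 1) (hnF : Tendsto (fun n : ℕ => (n : ℝ) * F (h n)) atTop atTop)
    {q : ℝ} (hq : q ≤ 1) (i : ℕ) :
    Tendsto (fun n : ℕ => 1 / (n : ℝ) * (F (h (i + 1)) / F (h n)) ^ q) atTop (𝓝 0) := by
  have hi := hpos (i + 1) (by omega)
  have hlim : Tendsto (fun n : ℕ => F (h (i + 1)) ^ q * ((n : ℝ) * F (h n))⁻¹) atTop (𝓝 0) := by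
    simpa using (tendsto_inv_atTop_zero.comp hnF).const_mul (F (h (i + 1)) ^ q)
  refine squeeze_zero' ?_ ?_ hlim
  · filter_upwards [eventually_ge_atTop 1] with n hn
    have := hpos n hn
    positivity
  · filter_upwards [eventually_ge_atTop 1] with n hn
    have hn' := hpos n hn
    have hn0 : (0 : ℝ) < n := by exact_mod_cast hn
    rw [Real.div_rpow hi.le hn'.le]
    have h1 : F (h n) ≤ F (h n) ^ q := by
      simpa using Real.rpow_le_rpow_of_exponent_ge hn' (hle _) hq
    calc 1 / (n : ℝ) * (F (h (i + 1)) ^ q / F (h n) ^ q)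
        ≤ 1 / (n : ℝ) * (F (h (i + 1)) ^ q / F (h n)) := by gcongr
      _ = _ := by field_simp

/-- The limits of the bandwidth means of opposite orders have a product at least `1`, by the
Cauchy-Schwarz inequality; in particular they do not vanish. -/
lemma bandwidth_limit_pos {F : ℝ → ℝ} {h : ℕ → ℝ} (hpos : ∀ n, 1 ≤ n → 0 < F (h n)) {q β β' : ℝ}
    (hβ : Tendsto (bandwidthB F h q) atTop (𝓝 β))
    (hβ' : Tendsto (bandwidthB F h (-q)) atTop (𝓝 β')) : 0 < β := by
  have hnonneg : ∀ᶠ n in atTop, 0 ≤ bandwidthB F h q n := by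
    filter_upwards [eventually_ge_atTop 1] with n hn
    rw [bandwidthB_eq_sum_range]
    refine Finset.sum_nonneg fun i _ => ?_
    have := hpos n hn
    have := hpos (i + 1) (by omega)
    positivity
  have hprod : ∀ᶠ n in atTop, 1 ≤ bandwidthB F h q n * bandwidthB F h (-q) n := by
    filter_upwards [eventually_ge_atTop 1] with n hn
    have hn' := hpos n hn
    have hn0 : (0 : ℝ) < n := by exact_mod_cast hn
    have hcs := Finset.sum_mul_sq_le_sq_mul_sq (Finset.range n)
      (fun i => (F (h (i + 1)) / F (h n)) ^ (q / 2))
      (fun i => (F (h (i + 1)) / F (h n)) ^ (-q / 2))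
    have hρ : ∀ i, 0 < F (h (i + 1)) / F (h n) := fun i => div_pos (hpos _ (by omega)) hn'
    have e1 : ∀ i, (F (h (i + 1)) / F (h n)) ^ (q / 2) * (F (h (i + 1)) / F (h n)) ^ (-q / 2)
        = 1 := by
      intro i
      rw [← Real.rpow_add (hρ i)]
      have : q / 2 + -q / 2 = 0 := by ring
      rw [this, Real.rpow_zero]
    have e2 : ∀ (p : ℝ) (i : ℕ), ((F (h (i + 1)) / F (h n)) ^ (p / 2)) ^ 2 = (F (h (i + 1)) / F (h n)) ^ p := by
      intro p i
      rw [← Real.rpow_natCast, ← Real.rpow_mul (hρ i).le]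
      congr 1
      push_cast
      ring
    simp only [e1, e2, Finset.sum_const, Finset.card_range, nsmul_eq_mul, mul_one] at hcs
    rw [bandwidthB, bandwidthB, sum_Icc_one_eq_sum_range, sum_Icc_one_eq_sum_range]
    calc (1 : ℝ) = 1 / (n : ℝ) * (1 / (n : ℝ)) * (n : ℝ) ^ 2 := by field_simp
      _ ≤ 1 / (n : ℝ) * (1 / (n : ℝ)) * ((∑ i ∈ Finset.range n, (F (h (i + 1)) / F (h n)) ^ q) *
            ∑ i ∈ Finset.range n, (F (h (i + 1)) / F (h n)) ^ (-q)) := by gcongr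
      _ = _ := by ring
  have h0 : 0 ≤ β := ge_of_tendsto hβ hnonneg
  have h1 : 1 ≤ β * β' := ge_of_tendsto (hβ.mul hβ') hprod
  refine lt_of_le_of_ne h0 fun h => ?_
  rw [← h, zero_mul] at h1
  linarith

/-! ### Numerator of the estimator -/

section Sums

variable {Ω : Type*} [MeasurableSpace Ω] {P : Measure Ω} [IsProbabilityMeasure P]

/-- Asymptotic normality of the numerator of the recursive estimator, in terms of the
distance `Z` to the point and the response `U` centred at the value of the regression function.
Beyond the first two kernel moments of `U`, only the existence of truncation levels `L n`,
negligible against `√(n F(h n))` and such that `U` has second moment `O(1 / n)` above `L n`, is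
needed. -/
theorem tendstoInDistribution_weighted_kernel_sum {Z U : Ω → ℝ} {Zs Us : ℕ → Ω → ℝ}
    (hindep : iIndepFun (fun (i : ℕ) ω => (Zs i ω, Us i ω)) P)
    (hident : ∀ i, IdentDistrib (fun ω => (Zs i ω, Us i ω)) (fun ω => (Z ω, U ω)) P P)
    (hU : MemLp U 2 P) {K : ℝ → ℝ} (hKm : Measurable K) (hK0 : ∀ t, 0 ≤ K t) {M : ℝ}
    (hKM : ∀ t, K t ≤ M) {F : ℝ → ℝ} {h : ℕ → ℝ} (hh : ∀ n, 1 ≤ n → 0 < h n)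
    (hh0 : Tendsto h atTop (𝓝 0)) (hpos : ∀ n, 1 ≤ n → 0 < F (h n)) (hle : ∀ t, F t ≤ 1)
    (hF0 : Tendsto (fun n => F (h n)) atTop (𝓝 0))
    (hnF : Tendsto (fun n : ℕ => (n : ℝ) * F (h n)) atTop atTop) {ℓ : ℝ} (hℓ : 0 ≤ ℓ)
    {b s : ℝ}
    (hb : Tendsto (fun n => (∫ ω, U ω * K (Z ω / h n) ∂P) / (h n * F (h n))) atTop (𝓝 b))
    (hs : Tendsto (fun n => (∫ ω, (U ω * K (Z ω / h n)) ^ 2 ∂P) / F (h n)) atTop (𝓝 s))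
    {L : ℕ → ℝ} {C : ℝ} (hL0 : ∀ n, 0 ≤ L n)
    (hL : Tendsto (fun n : ℕ => L n / √((n : ℝ) * F (h n))) atTop (𝓝 0))
    (hC : ∀ n : ℕ, 1 ≤ n →
      ∫ ω, Set.indicator {x : ℝ | L n < |x|} (fun x => x ^ 2) (U ω) ∂P ≤ C / n)
    {α : ℝ} (hα : Tendsto (bandwidthA F h ℓ) atTop (𝓝 α))
    {β : ℝ → ℝ} (hβ : ∀ q : ℝ, q ≤ 2 → Tendsto (bandwidthB F h q) atTop (𝓝 (β q)))
    {c : ℝ} (hc : Tendsto (fun n : ℕ => h n * √((n : ℝ) * F (h n))) atTop (𝓝 c)) :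
    TendstoInDistribution
      (fun (n : ℕ) ω => ∑ i ∈ Finset.range n, (√((n : ℝ) * F (h n)))⁻¹ *
        (F (h (i + 1)) / F (h n)) ^ (-ℓ) * (Us i ω * K (Zs i ω / h (i + 1))))
      atTop (id : ℝ → ℝ) (fun _ => P)
      (gaussianReal (c * α * b) (β (1 - 2 * ℓ) * s).toNNReal) := by
  set ρ : ℕ → ℕ → ℝ := fun n i => F (h (i + 1)) / F (h n) with hρdef
  set κ : ℕ → ℕ → ℝ := fun n i => (√((n : ℝ) * F (h n)))⁻¹ * ρ n i ^ (-ℓ) with hκdef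
  set V : ℕ → Ω → ℝ := fun n ω => U ω * K (Z ω / h n) with hVdef
  have hM0 : 0 ≤ M := (hK0 0).trans (hKM 0)
  have hZm : AEMeasurable Z P := (hident 0).aemeasurable_snd.fst
  have hKZ : ∀ n, AEStronglyMeasurable (fun ω => K (Z ω / h n)) P := fun n =>
    (hKm.comp_aemeasurable (hZm.div_const _)).aestronglyMeasurable
  have hV2 : ∀ n, MemLp (V n) 2 P := by
    intro n
    refine (hU.const_mul M).of_le (hU.1.mul (hKZ n)) (ae_of_all _ fun ω => ?_)
    simp only [hVdef, norm_mul, Real.norm_eq_abs, abs_of_nonneg (hK0 _), abs_of_nonneg hM0]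
    rw [mul_comm]
    exact mul_le_mul_of_nonneg_right (hKM _) (abs_nonneg _)
  have hψm : ∀ n, Measurable fun q : ℝ × ℝ => q.2 * K (q.1 / h n) := fun n =>
    measurable_snd.mul (hKm.comp (measurable_fst.div_const _))
  have hid : ∀ i, IdentDistrib (fun ω => Us i ω * K (Zs i ω / h (i + 1))) (V (i + 1)) P P :=
    fun i => (hident i).comp (hψm (i + 1))
  have hVs2 : ∀ i, MemLp (fun ω => Us i ω * K (Zs i ω / h (i + 1))) 2 P := fun i =>
    (hid i).symm.memLp_snd (hV2 _)
  -- positivity of the weights and the algebra relating them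
  have hρ0 : ∀ n, 1 ≤ n → ∀ i, 0 < ρ n i := fun n hn i => div_pos (hpos _ (by omega)) (hpos n hn)
  have hF' : ∀ n, 1 ≤ n → ∀ i, F (h (i + 1)) = ρ n i * F (h n) := fun n hn i =>
    (div_mul_cancel₀ _ (hpos n hn).ne').symm
  have hn0 : ∀ n : ℕ, 1 ≤ n → (0 : ℝ) < n := fun n hn => by exact_mod_cast hn
  have hsq : ∀ n : ℕ, 1 ≤ n → √((n : ℝ) * F (h n)) ^ 2 = n * F (h n) := fun n hn =>
    Real.sq_sqrt (mul_pos (hn0 n hn) (hpos n hn)).le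
  have hsq0 : ∀ n : ℕ, 1 ≤ n → 0 < √((n : ℝ) * F (h n)) := fun n hn =>
    Real.sqrt_pos.2 (mul_pos (hn0 n hn) (hpos n hn))
  have hρpow : ∀ n, 1 ≤ n → ∀ i, ∀ k : ℕ, ∀ q : ℝ,
      (ρ n i ^ (-ℓ)) ^ k * ρ n i ^ q = ρ n i ^ (q - k * ℓ) := by
    intro n hn i k q
    rw [← Real.rpow_natCast, ← Real.rpow_mul (hρ0 n hn i).le, ← Real.rpow_add (hρ0 n hn i)]
    congr 1
    ring
  have hκ0 : ∀ n, 1 ≤ n → ∀ i, 0 ≤ κ n i := fun n hn i =>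
    mul_nonneg (inv_nonneg.2 (Real.sqrt_nonneg _)) (Real.rpow_nonneg (hρ0 n hn i).le _)
  have hκsq : ∀ n, 1 ≤ n → ∀ i, κ n i ^ 2 = 1 / (n : ℝ) * (ρ n i ^ (-ℓ)) ^ 2 * (F (h n))⁻¹ := by
    intro n hn i
    simp only [hκdef]
    rw [mul_pow, inv_pow, hsq n hn]
    have := (hn0 n hn).ne'
    have := (hpos n hn).ne'
    field_simp
  have hmean : ∀ n i, ∫ ω, κ n i * (Us i ω * K (Zs i ω / h (i + 1))) ∂P =
      κ n i * ∫ ω, V (i + 1) ω ∂P := fun n i => by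
    rw [integral_const_mul, (hid i).integral_eq]
  have hsecond : ∀ n i, ∫ ω, (κ n i * (Us i ω * K (Zs i ω / h (i + 1)))) ^ 2 ∂P =
      κ n i ^ 2 * ∫ ω, V (i + 1) ω ^ 2 ∂P := fun n i => by
    simp only [mul_pow (κ n i)]
    rw [integral_const_mul]
    congr 1
    exact ((hid i).comp (measurable_id.pow_const 2)).integral_eq
  refine tendstoInDistribution_sum_of_lindeberg (ξ := fun n i ω =>
    κ n i * (Us i ω * K (Zs i ω / h (i + 1)))) (fun n => Finset.range n) ?_ ?_ ?_ ?_ ?_ ?_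
  · exact fun n => hindep.comp (fun i q => κ n i * (q.2 * K (q.1 / h (i + 1))))
      fun i => (hψm (i + 1)).const_mul _
  · exact fun n i => (hVs2 i).const_mul _
  · have hT := tendsto_sum_mul_of_tendsto
      (w := fun n i => h n * √((n : ℝ) * F (h n)) *
        (1 / (n : ℝ) * (h (i + 1) / h n * ρ n i ^ (1 - ℓ))))
      (x := fun i => (∫ ω, V (i + 1) ω ∂P) / (h (i + 1) * F (h (i + 1))))
      (L := c * α) (a := b) ?_ ?_ ?_ (hb.comp (tendsto_add_atTop_nat 1))
    · refine hT.congr' ?_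
      filter_upwards [eventually_ge_atTop 1] with n hn
      refine Finset.sum_congr rfl fun i _ => ?_
      rw [hmean]
      have h1 := (hn0 n hn).ne'
      have h2 := (hpos n hn).ne'
      have h3 := (hh n hn).ne'
      have h4 := (hh (i + 1) (by omega)).ne'
      have h5 := (hρ0 n hn i).ne'
      have h6 : ρ n i ^ (1 - ℓ) = ρ n i * ρ n i ^ (-ℓ) := by
        rw [sub_eq_add_neg, Real.rpow_add (hρ0 n hn i), Real.rpow_one]
      have h7 : (√((n : ℝ) * F (h n)))⁻¹ = √((n : ℝ) * F (h n)) / (n * F (h n)) := by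
        have hinv : ∀ x y : ℝ, x ≠ 0 → x ^ 2 = y → x⁻¹ = x / y := by
          rintro x _ hx rfl
          field_simp
        exact hinv _ _ (hsq0 n hn).ne' (hsq n hn)
      simp only [hκdef]
      rw [hF' n hn i, h6, h7]
      field_simp
    · filter_upwards [eventually_ge_atTop 1] with n hn i _
      have h1 := hn0 n hn
      have h3 := hh n hn
      have h4 := hh (i + 1) (by omega)
      have h5 := hρ0 n hn i
      positivity
    · refine (hc.mul hα).congr fun n => ?_
      rw [bandwidthA_eq_sum_range, Finset.mul_sum]
    · intro i
      -- the square of the weight is a multiple of the weight of order `1 - 2ℓ`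
      have hsqw : Tendsto (fun n : ℕ => √(h (i + 1) ^ 2 * F (h (i + 1)) *
          (1 / (n : ℝ) * ρ n i ^ (1 - 2 * ℓ)))) atTop (𝓝 0) := by
        have := ((tendsto_weight_zero hpos hle hnF (q := 1 - 2 * ℓ) (by linarith) i).const_mul
          (h (i + 1) ^ 2 * F (h (i + 1)))).sqrt
        simpa using this
      refine hsqw.congr' ?_
      filter_upwards [eventually_ge_atTop 1] with n hn
      have h1 := hn0 n hn
      have h2 := hpos n hn
      have h3 := hh n hn
      have h4 := hh (i + 1) (by omega)
      have h5 := hρ0 n hn i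
      have h6 : ρ n i ^ (1 - ℓ) = ρ n i * ρ n i ^ (-ℓ) := by
        rw [sub_eq_add_neg, Real.rpow_add h5, Real.rpow_one]
      have h7 : ρ n i ^ (1 - 2 * ℓ) = (ρ n i ^ (-ℓ)) ^ 2 * ρ n i := by
        have := hρpow n hn i 2 1
        rw [Real.rpow_one] at this
        rw [this]; norm_num
      have h8 : h (i + 1) ^ 2 * F (h (i + 1)) * (1 / (n : ℝ) * ρ n i ^ (1 - 2 * ℓ)) =
          (h n * √((n : ℝ) * F (h n)) *
            (1 / (n : ℝ) * (h (i + 1) / h n * ρ n i ^ (1 - ℓ)))) ^ 2 := by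
        rw [h6, h7, hF' n hn i]
        simp only [mul_pow, hsq n hn]
        field_simp
      rw [h8, Real.sqrt_sq (by positivity)]
  · -- the squared means have sum `O(F(h n))`
    have hxb := (hb.comp (tendsto_add_atTop_nat 1)).abs.bddAbove_range
    obtain ⟨Cx, hCx⟩ := hxb
    obtain ⟨Ch, hCh⟩ := (hh0.comp (tendsto_add_atTop_nat 1)).abs.bddAbove_range
    have hlim : Tendsto (fun n => Cx ^ 2 * Ch ^ 2 * (F (h n) * bandwidthB F h (2 - 2 * ℓ) n))
        atTop (𝓝 0) := by
      simpa using (hF0.mul (hβ (2 - 2 * ℓ) (by linarith))).const_mul (Cx ^ 2 * Ch ^ 2)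
    refine squeeze_zero' (Eventually.of_forall fun n => Finset.sum_nonneg fun i _ => sq_nonneg _)
      ?_ hlim
    filter_upwards [eventually_ge_atTop 1] with n hn
    rw [bandwidthB_eq_sum_range, Finset.mul_sum, Finset.mul_sum]
    refine Finset.sum_le_sum fun i _ => ?_
    have h1 : |(∫ ω, V (i + 1) ω ∂P) / (h (i + 1) * F (h (i + 1)))| ≤ Cx := hCx ⟨i, rfl⟩
    have h2 : |h (i + 1)| ≤ Ch := hCh ⟨i, rfl⟩
    have h3 := hpos n hn
    have h4 := hh (i + 1) (by omega)
    have h5 := hρ0 n hn i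
    have h6 := hn0 n hn
    rw [hmean, mul_pow, hκsq n hn]
    have h7 : ∫ ω, V (i + 1) ω ∂P = (∫ ω, V (i + 1) ω ∂P) / (h (i + 1) * F (h (i + 1))) *
        (h (i + 1) * (ρ n i * F (h n))) := by
      rw [← hF' n hn i]
      have := (hpos (i + 1) (by omega)).ne'
      field_simp
    rw [h7]
    set x := (∫ ω, V (i + 1) ω ∂P) / (h (i + 1) * F (h (i + 1)))
    have h8 : x ^ 2 ≤ Cx ^ 2 := by rw [← sq_abs]; gcongr
    have h9 : h (i + 1) ^ 2 ≤ Ch ^ 2 := by rw [← sq_abs]; gcongr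
    have h10 : ρ n i ^ (2 - 2 * ℓ) = (ρ n i ^ (-ℓ)) ^ 2 * ρ n i ^ 2 := by
      have := hρpow n hn i 2 2
      rw [Real.rpow_two] at this
      rw [this]; norm_num
    change _ ≤ Cx ^ 2 * Ch ^ 2 * (F (h n) * (1 / (n : ℝ) * ρ n i ^ (2 - 2 * ℓ)))
    rw [h10]
    calc 1 / (n : ℝ) * (ρ n i ^ (-ℓ)) ^ 2 * (F (h n))⁻¹ * (x * (h (i + 1) * (ρ n i * F (h n)))) ^ 2
        = x ^ 2 * h (i + 1) ^ 2 * (F (h n) * (1 / (n : ℝ) * ((ρ n i ^ (-ℓ)) ^ 2 * ρ n i ^ 2))) := by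
          field_simp
      _ ≤ _ := by gcongr
  · have hT := tendsto_sum_mul_of_tendsto
      (w := fun n i => 1 / (n : ℝ) * ρ n i ^ (1 - 2 * ℓ))
      (x := fun i => (∫ ω, V (i + 1) ω ^ 2 ∂P) / F (h (i + 1)))
      (L := β (1 - 2 * ℓ)) (a := s) ?_ ?_
      (fun i => tendsto_weight_zero hpos hle hnF (by linarith) i)
      (hs.comp (tendsto_add_atTop_nat 1))
    · refine hT.congr' ?_
      filter_upwards [eventually_ge_atTop 1] with n hn
      refine Finset.sum_congr rfl fun i _ => ?_
      have h10 : ρ n i ^ (1 - 2 * ℓ) = (ρ n i ^ (-ℓ)) ^ 2 * ρ n i := by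
        have := hρpow n hn i 2 1
        rw [Real.rpow_one] at this
        rw [this]; norm_num
      rw [hsecond, hκsq n hn, hF' n hn i, h10]
      have h1 := (hn0 n hn).ne'
      have h2 := (hpos n hn).ne'
      have h5 := (hρ0 n hn i).ne'
      field_simp
    · filter_upwards [eventually_ge_atTop 1] with n hn i _
      have h1 := hn0 n hn
      have h5 := hρ0 n hn i
      positivity
    · exact (hβ (1 - 2 * ℓ) (by linarith)).congr fun n => bandwidthB_eq_sum_range F h _ n
  · intro ε hε
    obtain ⟨Cs, hCs⟩ := (hs.comp (tendsto_add_atTop_nat 1)).bddAbove_range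
    have hlim : Tendsto (fun n : ℕ => M ^ 2 * C * (((n : ℝ) * F (h n))⁻¹ * bandwidthB F h (-2 * ℓ) n)
        + M / ε * Cs * (L n / √((n : ℝ) * F (h n)) * bandwidthB F h (1 - 3 * ℓ) n))
        atTop (𝓝 0) := by
      have h1 := ((tendsto_inv_atTop_zero.comp hnF).mul
        (hβ (-2 * ℓ) (by linarith))).const_mul (M ^ 2 * C)
      have h2 := (hL.mul (hβ (1 - 3 * ℓ) (by linarith))).const_mul (M / ε * Cs)
      simpa using h1.add h2
    refine squeeze_zero' (Eventually.of_forall fun n => Finset.sum_nonneg fun i _ =>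
      integral_nonneg fun ω => Set.indicator_nonneg (fun x _ => sq_nonneg x) _) ?_ hlim
    filter_upwards [eventually_ge_atTop 1] with n hn
    rw [bandwidthB_eq_sum_range, bandwidthB_eq_sum_range, Finset.mul_sum, Finset.mul_sum,
      Finset.mul_sum, Finset.mul_sum, ← Finset.sum_add_distrib]
    refine Finset.sum_le_sum fun i _ => ?_
    have h1 := hn0 n hn
    have h2 := hpos n hn
    have h5 := hρ0 n hn i
    have hκ := hκ0 n hn i
    -- either the response exceeds the truncation level, or it gains a factor `κ M L / ε`
    have hpt : ∀ ω, Set.indicator {x : ℝ | ε < |x|} (fun x => x ^ 2) (κ n i * V (i + 1) ω) ≤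
        κ n i ^ 2 * M ^ 2 * Set.indicator {x : ℝ | L n < |x|} (fun x => x ^ 2) (U ω) +
          κ n i * M * L n / ε * κ n i ^ 2 * V (i + 1) ω ^ 2 := by
      intro ω
      have hA : 0 ≤ κ n i ^ 2 * M ^ 2 *
          Set.indicator {x : ℝ | L n < |x|} (fun x => x ^ 2) (U ω) :=
        mul_nonneg (by positivity) (Set.indicator_nonneg (fun x _ => sq_nonneg x) _)
      have hB : 0 ≤ κ n i * M * L n / ε * κ n i ^ 2 * V (i + 1) ω ^ 2 := by
        have := hL0 n
        positivity
      have hk0 := hK0 (Z ω / h (i + 1))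
      have hkM := hKM (Z ω / h (i + 1))
      by_cases hx : ε < |κ n i * V (i + 1) ω|
      · rw [Set.indicator_of_mem (by exact hx)]
        by_cases hu : L n < |U ω|
        · rw [Set.indicator_of_mem (by exact hu)]
          have : (κ n i * V (i + 1) ω) ^ 2 ≤ κ n i ^ 2 * M ^ 2 * U ω ^ 2 := by
            have : (κ n i * V (i + 1) ω) ^ 2 = κ n i ^ 2 * K (Z ω / h (i + 1)) ^ 2 * U ω ^ 2 := by
              simp only [hVdef]; ring
            rw [this]
            gcongr
          linarith
        · have hle' : ε ≤ κ n i * M * L n := by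
            have : |κ n i * V (i + 1) ω| = κ n i * (K (Z ω / h (i + 1)) * |U ω|) := by
              simp only [hVdef, abs_mul, abs_of_nonneg hκ, abs_of_nonneg hk0]; ring
            rw [this] at hx
            have h6 : K (Z ω / h (i + 1)) * |U ω| ≤ M * L n :=
              mul_le_mul hkM (not_lt.1 hu) (abs_nonneg _) hM0
            have h7 := mul_le_mul_of_nonneg_left h6 hκ
            linarith
          have h8 : 1 ≤ κ n i * M * L n / ε := (one_le_div hε).2 hle'
          have h9 : 1 * (κ n i ^ 2 * V (i + 1) ω ^ 2) ≤
              κ n i * M * L n / ε * (κ n i ^ 2 * V (i + 1) ω ^ 2) :=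
            mul_le_mul_of_nonneg_right h8 (by positivity)
          rw [mul_pow]
          linarith
      · rw [Set.indicator_of_notMem (by exact hx)]
        linarith
    have hLam : ∫ ω, Set.indicator {x : ℝ | ε < |x|} (fun x => x ^ 2)
        (κ n i * (Us i ω * K (Zs i ω / h (i + 1)))) ∂P ≤
        κ n i ^ 2 * M ^ 2 * (C / n) +
          κ n i * M * L n / ε * κ n i ^ 2 * ∫ ω, V (i + 1) ω ^ 2 ∂P := by
      have hmeas : Measurable fun y : ℝ =>
          Set.indicator {x : ℝ | ε < |x|} (fun x : ℝ => x ^ 2) (κ n i * y) :=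
        ((measurable_id.pow_const 2).indicator
          (measurableSet_lt measurable_const measurable_id.abs)).comp (measurable_id.const_mul _)
      have heq := ((hid i).comp hmeas).integral_eq
      simp only [Function.comp_def] at heq
      rw [heq]
      have hi1 := integrable_indicator_sq ((hV2 (i + 1)).const_mul (κ n i)) ε
      have hi2 := (integrable_indicator_sq hU (L n)).const_mul (κ n i ^ 2 * M ^ 2)
      have hi3 := (hV2 (i + 1)).integrable_sq.const_mul (κ n i * M * L n / ε * κ n i ^ 2)
      refine (integral_mono hi1 (hi2.add hi3) hpt).trans ?_
      have := integral_add hi2 hi3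
      rw [integral_const_mul, integral_const_mul] at this
      refine this.le.trans ?_
      have := hC n hn
      gcongr
    refine hLam.trans (add_le_add (le_of_eq ?_) ?_)
    · have h10 : ρ n i ^ (-2 * ℓ) = (ρ n i ^ (-ℓ)) ^ 2 := by
        have := hρpow n hn i 2 0
        rw [Real.rpow_zero, mul_one] at this
        rw [this]; congr 1; push_cast; ring
      change _ = M ^ 2 * C * (((n : ℝ) * F (h n))⁻¹ * (1 / (n : ℝ) * ρ n i ^ (-2 * ℓ)))
      rw [hκsq n hn, h10]
      field_simp
    · have h6 : (∫ ω, V (i + 1) ω ^ 2 ∂P) / F (h (i + 1)) ≤ Cs := hCs ⟨i, rfl⟩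
      have h7 : ∫ ω, V (i + 1) ω ^ 2 ∂P ≤ Cs * (ρ n i * F (h n)) := by
        rw [← hF' n hn i]
        exact (div_le_iff₀ (hpos (i + 1) (by omega))).1 h6
      have h10 : ρ n i ^ (1 - 3 * ℓ) = (ρ n i ^ (-ℓ)) ^ 3 * ρ n i := by
        have := hρpow n hn i 3 1
        rw [Real.rpow_one] at this
        rw [this]; norm_num
      change _ ≤ M / ε * Cs * (L n / √((n : ℝ) * F (h n)) * (1 / (n : ℝ) * ρ n i ^ (1 - 3 * ℓ)))
      have h11 := hL0 n
      have h12 := (hsq0 n hn).ne'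
      calc κ n i * M * L n / ε * κ n i ^ 2 * ∫ ω, V (i + 1) ω ^ 2 ∂P
          ≤ κ n i * M * L n / ε * κ n i ^ 2 * (Cs * (ρ n i * F (h n))) := by gcongr
        _ = _ := by
          rw [hκsq n hn, h10]
          simp only [hκdef]
          field_simp

end Sums

/-! ### Denominator and quotient -/

/-- Convergence in probability to a constant, by Chebyshev's inequality. -/
lemma tendstoInMeasure_const_of_tendsto_variance {Ω : Type*} [MeasurableSpace Ω] {P : Measure Ω}
    [IsProbabilityMeasure P] {D : ℕ → Ω → ℝ} {d : ℝ} (hD : ∀ n, MemLp (D n) 2 P)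
    (hmean : Tendsto (fun n => ∫ ω, D n ω ∂P) atTop (𝓝 d))
    (hvar : Tendsto (fun n => Var[D n; P]) atTop (𝓝 0)) :
    TendstoInMeasure P D atTop (fun _ => d) := by
  rw [tendstoInMeasure_iff_norm]
  intro ε hε
  have hlim : Tendsto (fun n => ENNReal.ofReal (Var[D n; P] / (ε / 2) ^ 2)) atTop (𝓝 0) := by
    have := ENNReal.tendsto_ofReal (hvar.div_const ((ε / 2) ^ 2))
    simpa using this
  refine tendsto_of_tendsto_of_tendsto_of_le_of_le' tendsto_const_nhds hlim
    (Eventually.of_forall fun _ => zero_le) ?_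
  have hclose : ∀ᶠ n in atTop, |∫ ω, D n ω ∂P - d| < ε / 2 := by
    have := Metric.tendsto_nhds.1 hmean (ε / 2) (by positivity)
    simpa only [Real.dist_eq] using this
  filter_upwards [hclose] with n hn
  refine (measure_mono fun ω hω => ?_).trans
    (meas_ge_le_variance_div_sq (hD n) (c := ε / 2) (by positivity))
  have h1 : ε ≤ |D n ω - d| := hω
  have h2 : |D n ω - d| ≤ |D n ω - ∫ ω, D n ω ∂P| + |∫ ω, D n ω ∂P - d| := abs_sub_le _ _ _
  change ε / 2 ≤ |D n ω - ∫ ω, D n ω ∂P|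
  linarith

/-- A quotient with an asymptotically normal numerator and a denominator converging in probability
to a positive constant is asymptotically normal, whatever value the quotient is given where the
denominator is not positive. -/
theorem tendstoInDistribution_div_of_tendstoInMeasure {Ω : Type*} [MeasurableSpace Ω]
    {P : Measure Ω} [IsProbabilityMeasure P] {S D T : ℕ → Ω → ℝ} {m d : ℝ} {v : NNReal}
    (hd : 0 < d)
    (hS : TendstoInDistribution S atTop (id : ℝ → ℝ) (fun _ => P) (gaussianReal m v))
    (hD : TendstoInMeasure P D atTop (fun _ => d)) (hDm : ∀ n, AEMeasurable (D n) P)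
    (hTm : ∀ n, AEMeasurable (T n) P)
    (hT : ∀ᶠ n in atTop, ∀ ω, 0 < D n ω → T n ω = S n ω / D n ω) :
    TendstoInDistribution T atTop (id : ℝ → ℝ) (fun _ => P)
      (gaussianReal (m / d) (v / (d ^ 2).toNNReal)) := by
  -- the quotient with a denominator kept away from zero is a continuous function of the pair
  set g : ℝ × ℝ → ℝ := fun q => q.1 * (max q.2 (d / 2))⁻¹ with hg
  have hgc : Continuous g := by
    refine continuous_fst.mul (Continuous.inv₀ (by fun_prop) fun q => ?_)
    have : 0 < max q.2 (d / 2) := lt_max_of_lt_right (by positivity)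
    exact this.ne'
  have hG := hS.continuous_comp_prodMk_of_tendstoInMeasure_const hgc hD hDm
  have hmax : max d (d / 2) = d := max_eq_left (by linarith)
  have hlimit : TendstoInDistribution T atTop (fun x : ℝ => g (id x, d)) (fun _ => P)
      (gaussianReal m v) := by
    refine tendstoInDistribution_of_tendstoInMeasure_sub T _ hG ?_ hTm
    intro ε hε
    have hsmall := hD (ENNReal.ofReal (d / 2)) (by simpa using hd)
    refine tendsto_of_tendsto_of_tendsto_of_le_of_le' tendsto_const_nhds hsmall
      (Eventually.of_forall fun _ => zero_le) ?_
    filter_upwards [hT] with n hn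
    refine measure_mono fun ω hω => ?_
    by_contra hcon
    have h1 : |D n ω - d| < d / 2 := by
      have h2 : edist (D n ω) d < ENNReal.ofReal (d / 2) := not_le.1 hcon
      rw [edist_dist, ENNReal.ofReal_lt_ofReal_iff (by positivity), Real.dist_eq] at h2
      exact h2
    have h2 : d / 2 < D n ω := by linarith [(abs_lt.1 h1).1]
    have h3 : (T - fun n ω => g (S n ω, D n ω)) n ω = 0 := by
      simp only [Pi.sub_apply, hg]
      rw [hn ω (by linarith), max_eq_left h2.le, div_eq_mul_inv, sub_self]
    have h4 : ε ≤ edist ((T - fun n ω => g (S n ω, D n ω)) n ω) ((0 : Ω → ℝ) ω) := hω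
    rw [h3] at h4
    simp only [Pi.zero_apply, edist_self] at h4
    exact hε.not_ge h4
  have hmap : (gaussianReal m v).map (fun x : ℝ => g (id x, d)) =
      (gaussianReal (m / d) (v / (d ^ 2).toNNReal)).map id := by
    have : (fun x : ℝ => g (id x, d)) = fun x => x / d := by
      ext x
      simp only [hg, id]
      rw [hmax, div_eq_mul_inv]
    rw [this, gaussianReal_map_div_const, Measure.map_id]
    congr 2
    ext
    simp [sq_nonneg]
  refine ⟨hTm, aemeasurable_id, ?_⟩
  have := hlimit.tendsto
  convert! this using 2
  exact congrArg 𝓝 (Subtype.ext hmap.symm)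

section Sums

variable {Ω : Type*} [MeasurableSpace Ω] {P : Measure Ω} [IsProbabilityMeasure P]

/-- The weak law of large numbers for the denominator of the recursive estimator. -/
theorem tendstoInMeasure_weighted_kernel_sum {Z : Ω → ℝ} {Zs : ℕ → Ω → ℝ}
    (hindep : iIndepFun Zs P) (hident : ∀ i, IdentDistrib (Zs i) Z P P) {K : ℝ → ℝ}
    (hKm : Measurable K) (hK0 : ∀ t, 0 ≤ K t) {M : ℝ} (hKM : ∀ t, K t ≤ M) {F : ℝ → ℝ} {h : ℕ → ℝ}
    (hpos : ∀ n, 1 ≤ n → 0 < F (h n)) (hle : ∀ t, F t ≤ 1)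
    (hnF : Tendsto (fun n : ℕ => (n : ℝ) * F (h n)) atTop atTop) {ℓ : ℝ} (hℓ : 0 ≤ ℓ) {s : ℝ}
    (hs : Tendsto (fun n => (∫ ω, K (Z ω / h n) ∂P) / F (h n)) atTop (𝓝 s)) {β : ℝ → ℝ}
    (hβ : ∀ q : ℝ, q ≤ 2 → Tendsto (bandwidthB F h q) atTop (𝓝 (β q))) :
    TendstoInMeasure P (fun (n : ℕ) ω => ∑ i ∈ Finset.range n, ((n : ℝ) * F (h n))⁻¹ *
        (F (h (i + 1)) / F (h n)) ^ (-ℓ) * K (Zs i ω / h (i + 1)))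
      atTop (fun _ => β (1 - ℓ) * s) := by
  set ρ : ℕ → ℕ → ℝ := fun n i => F (h (i + 1)) / F (h n) with hρdef
  set κ : ℕ → ℕ → ℝ := fun n i => ((n : ℝ) * F (h n))⁻¹ * ρ n i ^ (-ℓ) with hκdef
  have hM0 : 0 ≤ M := (hK0 0).trans (hKM 0)
  have hψm : ∀ n, Measurable fun z : ℝ => K (z / h n) := fun n =>
    hKm.comp (measurable_id.div_const _)
  have hid : ∀ i, IdentDistrib (fun ω => K (Zs i ω / h (i + 1)))
      (fun ω => K (Z ω / h (i + 1))) P P := fun i => (hident i).comp (hψm (i + 1))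
  have hK2 : ∀ i, MemLp (fun ω => K (Zs i ω / h (i + 1))) 2 P := fun i =>
    MemLp.of_bound (hid i).aemeasurable_fst.aestronglyMeasurable M (ae_of_all _ fun ω => by
      rw [Real.norm_eq_abs, abs_of_nonneg (hK0 _)]; exact hKM _)
  have hξ2 : ∀ n i, MemLp (fun ω => κ n i * K (Zs i ω / h (i + 1))) 2 P := fun n i =>
    (hK2 i).const_mul _
  have hρ0 : ∀ n, 1 ≤ n → ∀ i, 0 < ρ n i := fun n hn i => div_pos (hpos _ (by omega)) (hpos n hn)
  have hF' : ∀ n, 1 ≤ n → ∀ i, F (h (i + 1)) = ρ n i * F (h n) := fun n hn i =>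
    (div_mul_cancel₀ _ (hpos n hn).ne').symm
  have hn0 : ∀ n : ℕ, 1 ≤ n → (0 : ℝ) < n := fun n hn => by exact_mod_cast hn
  refine tendstoInMeasure_const_of_tendsto_variance
    (fun n => memLp_finsetSum _ fun i _ => hξ2 n i) ?_ ?_
  · have hT := tendsto_sum_mul_of_tendsto
      (w := fun n i => 1 / (n : ℝ) * ρ n i ^ (1 - ℓ))
      (x := fun i => (∫ ω, K (Z ω / h (i + 1)) ∂P) / F (h (i + 1)))
      (L := β (1 - ℓ)) (a := s) ?_ ?_
      (fun i => tendsto_weight_zero hpos hle hnF (by linarith) i)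
      (hs.comp (tendsto_add_atTop_nat 1))
    · refine hT.congr' ?_
      filter_upwards [eventually_ge_atTop 1] with n hn
      rw [integral_finsetSum _ fun i _ => (hξ2 n i).integrable (by norm_num)]
      refine Finset.sum_congr rfl fun i _ => ?_
      rw [integral_const_mul, (hid i).integral_eq, hF' n hn i, sub_eq_add_neg,
        Real.rpow_add (hρ0 n hn i), Real.rpow_one]
      have h1 := (hn0 n hn).ne'
      have h2 := (hpos n hn).ne'
      have h5 := (hρ0 n hn i).ne'
      simp only [hκdef]
      field_simp
    · filter_upwards [eventually_ge_atTop 1] with n hn i _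
      have h1 := hn0 n hn
      have h5 := hρ0 n hn i
      positivity
    · exact (hβ (1 - ℓ) (by linarith)).congr fun n => bandwidthB_eq_sum_range F h _ n
  · obtain ⟨Cs, hCs⟩ := (hs.comp (tendsto_add_atTop_nat 1)).bddAbove_range
    have hlim : Tendsto (fun n : ℕ => M * Cs * (((n : ℝ) * F (h n))⁻¹ *
        bandwidthB F h (1 - 2 * ℓ) n)) atTop (𝓝 0) := by
      have := ((tendsto_inv_atTop_zero.comp hnF).mul
        (hβ (1 - 2 * ℓ) (by linarith))).const_mul (M * Cs)
      simpa using this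
    refine squeeze_zero' (Eventually.of_forall fun n => variance_nonneg _ _) ?_ hlim
    filter_upwards [eventually_ge_atTop 1] with n hn
    have hind : iIndepFun (fun i ω => κ n i * K (Zs i ω / h (i + 1))) P :=
      hindep.comp (fun i z => κ n i * K (z / h (i + 1))) fun i => (hψm (i + 1)).const_mul _
    have hvar : Var[fun ω => ∑ i ∈ Finset.range n, κ n i * K (Zs i ω / h (i + 1)); P] =
        ∑ i ∈ Finset.range n, Var[fun ω => κ n i * K (Zs i ω / h (i + 1)); P] := by
      have := IndepFun.variance_sum (s := Finset.range n) (fun i _ => hξ2 n i)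
        (fun i _ j _ hij => hind.indepFun hij)
      rw [← this]
      congr 1
      ext ω
      simp
    rw [hvar, bandwidthB_eq_sum_range, Finset.mul_sum, Finset.mul_sum]
    refine Finset.sum_le_sum fun i _ => ?_
    have h1 := hn0 n hn
    have h2 := hpos n hn
    have h5 := hρ0 n hn i
    have h3 : Var[fun ω => K (Zs i ω / h (i + 1)); P] ≤ M * (Cs * (ρ n i * F (h n))) := by
      have h6 : (∫ ω, K (Z ω / h (i + 1)) ∂P) / F (h (i + 1)) ≤ Cs := hCs ⟨i, rfl⟩
      have h7 : ∫ ω, K (Z ω / h (i + 1)) ∂P ≤ Cs * (ρ n i * F (h n)) := by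
        rw [← hF' n hn i]
        exact (div_le_iff₀ (hpos (i + 1) (by omega))).1 h6
      refine (variance_le_expectation_sq (hK2 i).1).trans ?_
      calc ∫ ω, ((fun ω => K (Zs i ω / h (i + 1))) ^ 2) ω ∂P
          ≤ ∫ ω, M * K (Zs i ω / h (i + 1)) ∂P := by
            refine integral_mono (hK2 i).integrable_sq
              (((hK2 i).integrable (by norm_num)).const_mul M) fun ω => ?_
            simp only [Pi.pow_apply, sq]
            exact mul_le_mul_of_nonneg_right (hKM _) (hK0 _)
        _ = M * ∫ ω, K (Z ω / h (i + 1)) ∂P := by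
            rw [integral_const_mul, (hid i).integral_eq]
        _ ≤ _ := by gcongr
    have h10 : ρ n i ^ (1 - 2 * ℓ) = (ρ n i ^ (-ℓ)) ^ 2 * ρ n i := by
      rw [← Real.rpow_natCast, ← Real.rpow_mul h5.le]
      nth_rewrite 3 [← Real.rpow_one (ρ n i)]
      rw [← Real.rpow_add h5]
      congr 1
      push_cast
      ring
    rw [variance_const_mul]
    change _ ≤ M * Cs * (((n : ℝ) * F (h n))⁻¹ * (1 / (n : ℝ) * ρ n i ^ (1 - 2 * ℓ)))
    calc κ n i ^ 2 * Var[fun ω => K (Zs i ω / h (i + 1)); P]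
        ≤ κ n i ^ 2 * (M * (Cs * (ρ n i * F (h n)))) := by gcongr
      _ = _ := by
        rw [h10]
        simp only [hκdef]
        field_simp

end Sums

/-! ### Truncation under an exponential moment -/

/-- Every square is dominated by a stretched exponential. -/
lemma exists_sq_le_mul_exp_rpow {a b : ℝ} (ha : 0 < a) (hb : 0 < b) :
    ∃ C : ℝ, 0 < C ∧ ∀ x : ℝ, x ^ 2 ≤ C * Real.exp (a * |x| ^ b) := by
  obtain ⟨k, hk⟩ := exists_nat_gt (2 / b)
  refine ⟨1 + k.factorial / a ^ k, by positivity, fun x => ?_⟩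
  have hexp : 1 ≤ Real.exp (a * |x| ^ b) := Real.one_le_exp (by positivity)
  have hpow : |x| ^ (b * k) ≤ k.factorial / a ^ k * Real.exp (a * |x| ^ b) := by
    have := Real.pow_div_factorial_le_exp (a * |x| ^ b) (by positivity) k
    rw [mul_pow, div_le_iff₀ (by positivity), ← Real.rpow_natCast (|x| ^ b),
      ← Real.rpow_mul (abs_nonneg x)] at this
    rw [div_mul_eq_mul_div, le_div_iff₀ (by positivity)]
    linarith
  have hx : x ^ 2 ≤ 1 + |x| ^ (b * k) := by
    rw [← sq_abs]
    rcases le_total |x| 1 with h | h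
    · have h1 : |x| ^ 2 ≤ 1 := pow_le_one₀ (abs_nonneg x) h
      have h2 : 0 ≤ |x| ^ (b * k) := by positivity
      linarith
    · have h2 : (2 : ℝ) ≤ b * k := by
        rw [div_lt_iff₀ hb] at hk
        linarith
      have h3 : |x| ^ (2 : ℝ) ≤ |x| ^ (b * k) := Real.rpow_le_rpow_of_exponent_le h h2
      rw [Real.rpow_two] at h3
      linarith
  nlinarith

/-- A stretched exponential moment is not affected by a translation of the variable, at the cost of
a smaller exponent. -/
lemma exists_integrable_exp_sub_const {Ω : Type*} [MeasurableSpace Ω] {P : Measure Ω}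
    [IsProbabilityMeasure P] {Y : Ω → ℝ} (hY : Measurable Y) (y : ℝ)
    (hexp : ∃ a b : ℝ, 0 < a ∧ 0 < b ∧ Integrable (fun ω => Real.exp (a * |Y ω| ^ b)) P) :
    ∃ a b : ℝ, 0 < a ∧ 0 < b ∧ Integrable (fun ω => Real.exp (a * |Y ω - y| ^ b)) P := by
  obtain ⟨a, b, ha, hb, hint⟩ := hexp
  refine ⟨a, min b 1, ha, lt_min hb one_pos, ?_⟩
  refine (hint.const_mul (Real.exp (a * (1 + |y| ^ (min b 1))))).mono'
    ((((hY.sub_const y).abs.pow_const _).const_mul a).exp.aestronglyMeasurable)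
    (ae_of_all _ fun ω => ?_)
  rw [Real.norm_eq_abs, Real.abs_exp, ← Real.exp_add]
  refine Real.exp_le_exp.2 ?_
  have h0 : 0 ≤ min b 1 := (lt_min hb one_pos).le
  have h1 : |Y ω - y| ^ (min b 1) ≤ |Y ω| ^ (min b 1) + |y| ^ (min b 1) :=
    (Real.rpow_le_rpow (abs_nonneg _) (abs_sub _ _) h0).trans
      (Real.rpow_add_le_add_rpow (abs_nonneg _) (abs_nonneg _) h0 (min_le_right _ _))
  have h2 : |Y ω| ^ (min b 1) ≤ 1 + |Y ω| ^ b := by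
    rcases le_total |Y ω| 1 with h | h
    · have h3 := Real.rpow_le_one (abs_nonneg _) h h0
      have h4 : 0 ≤ |Y ω| ^ b := by positivity
      linarith
    · have := Real.rpow_le_rpow_of_exponent_le h (min_le_left b 1)
      linarith
  nlinarith

lemma memLp_two_of_integrable_exp {Ω : Type*} [MeasurableSpace Ω] {P : Measure Ω} {U : Ω → ℝ}
    (hU : Measurable U)
    (hexp : ∃ a b : ℝ, 0 < a ∧ 0 < b ∧ Integrable (fun ω => Real.exp (a * |U ω| ^ b)) P) :
    MemLp U 2 P := by
  obtain ⟨a, b, ha, hb, hint⟩ := hexp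
  obtain ⟨C, _, hC⟩ := exists_sq_le_mul_exp_rpow ha hb
  rw [memLp_two_iff_integrable_sq hU.aestronglyMeasurable]
  refine (hint.const_mul C).mono' (by fun_prop) (ae_of_all _ fun ω => ?_)
  rw [Real.norm_eq_abs, abs_of_nonneg (sq_nonneg _)]
  exact hC _

/-- Under a stretched exponential moment, truncation at a suitable power of `ln n` leaves a second
moment of order `1 / n`. -/
lemma exists_truncation_of_integrable_exp {Ω : Type*} [MeasurableSpace Ω] {P : Measure Ω}
    {U : Ω → ℝ} (hU : Measurable U)
    (hexp : ∃ a b : ℝ, 0 < a ∧ 0 < b ∧ Integrable (fun ω => Real.exp (a * |U ω| ^ b)) P) :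
    ∃ A δ C : ℝ, 0 ≤ A ∧ 0 < δ ∧ ∀ n : ℕ, 1 ≤ n →
      ∫ ω, Set.indicator {x : ℝ | A * Real.log n ^ δ < |x|} (fun x => x ^ 2) (U ω) ∂P ≤ C / n := by
  have hU2 := memLp_two_of_integrable_exp hU hexp
  obtain ⟨a, b, ha, hb, hint⟩ := hexp
  obtain ⟨C, hC0, hC⟩ := exists_sq_le_mul_exp_rpow (half_pos ha) hb
  refine ⟨(2 / a) ^ (1 / b), 1 / b, C * ∫ ω, Real.exp (a * |U ω| ^ b) ∂P, by positivity,
    by positivity, fun n hn => ?_⟩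
  have hn0 : (0 : ℝ) < n := by exact_mod_cast hn
  have hlog : 0 ≤ Real.log n := Real.log_natCast_nonneg n
  -- half of the exponent is spent on the factor `1 / n`, the other half on the square
  have hpt : ∀ ω, Set.indicator {x : ℝ | (2 / a) ^ (1 / b) * Real.log n ^ (1 / b) < |x|}
      (fun x => x ^ 2) (U ω) ≤ C / n * Real.exp (a * |U ω| ^ b) := by
    intro ω
    by_cases hx : (2 / a) ^ (1 / b) * Real.log n ^ (1 / b) < |U ω|
    · rw [Set.indicator_of_mem (by exact hx)]
      rw [← Real.mul_rpow (by positivity) hlog] at hx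
      have h1 : 2 / a * Real.log n ≤ |U ω| ^ b := by
        have := Real.rpow_le_rpow (by positivity) hx.le hb.le
        rwa [← Real.rpow_mul (by positivity), one_div_mul_cancel hb.ne', Real.rpow_one] at this
      have h2 : Real.log n ≤ a / 2 * |U ω| ^ b := by
        rw [div_mul_eq_mul_div, div_le_iff₀ ha] at h1
        linarith
      have h3 : (n : ℝ) ≤ Real.exp (a / 2 * |U ω| ^ b) := by
        rw [← Real.exp_log hn0]
        exact Real.exp_le_exp.2 h2
      have h4 : Real.exp (a * |U ω| ^ b) =
          Real.exp (a / 2 * |U ω| ^ b) * Real.exp (a / 2 * |U ω| ^ b) := by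
        rw [← Real.exp_add]; congr 1; ring
      rw [h4, div_mul_eq_mul_div, le_div_iff₀ hn0]
      calc U ω ^ 2 * n ≤ C * Real.exp (a / 2 * |U ω| ^ b) * Real.exp (a / 2 * |U ω| ^ b) :=
            mul_le_mul (hC _) h3 hn0.le (by positivity)
        _ = _ := by ring
    · rw [Set.indicator_of_notMem (by exact hx)]
      positivity
  refine (integral_mono (integrable_indicator_sq hU2 _) (hint.const_mul (C / n)) hpt).trans ?_
  rw [integral_const_mul]
  exact le_of_eq (by ring)

/-! ### Local averages at a point -/

lemma abs_mul_kernel_le {Ω : Type*} {Z W : Ω → ℝ} {G : ℝ → ℝ} {w η δ h : ℝ}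
    (hG0 : ∀ t, 0 ≤ G t) (hsupp : ∀ t, t ∉ Set.Icc (0 : ℝ) 1 → G t = 0) (hh : 0 < h) (hδ : h < δ)
    (hW : ∀ ω, Z ω < δ → |W ω - w| ≤ η) (ω : Ω) :
    |(W ω - w) * G (Z ω / h)| ≤ η * G (Z ω / h) := by
  rw [abs_mul, abs_of_nonneg (hG0 _)]
  by_cases hZ : Z ω ≤ h
  · exact mul_le_mul_of_nonneg_right (hW ω (hZ.trans_lt hδ)) (hG0 _)
  · rw [hsupp _ fun h2 => hZ ((div_le_one hh).1 h2.2)]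
    simp

section LocalAverage

variable {Ω : Type*} [MeasurableSpace Ω] {P : Measure Ω} [IsProbabilityMeasure P]

/-- A variable `W` close to `w` wherever `Z` is small stays integrable after localization. -/
lemma integrable_mul_kernel {Z W : Ω → ℝ} (hZ : Measurable Z) (hWm : Measurable W) {G : ℝ → ℝ}
    (hGm : Measurable G) (hG0 : ∀ t, 0 ≤ G t) {M : ℝ} (hGM : ∀ t, G t ≤ M)
    (hsupp : ∀ t, t ∉ Set.Icc (0 : ℝ) 1 → G t = 0) {w η δ h : ℝ} (hh : 0 < h) (hδ : h < δ)
    (hW : ∀ ω, Z ω < δ → |W ω - w| ≤ η) :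
    Integrable (fun ω => W ω * G (Z ω / h)) P := by
  have hGZ : Measurable fun ω => G (Z ω / h) := hGm.comp (hZ.div_const h)
  have hGi : Integrable (fun ω => G (Z ω / h)) P :=
    Integrable.of_bound hGZ.aestronglyMeasurable M (ae_of_all _ fun ω => by
      rw [Real.norm_eq_abs, abs_of_nonneg (hG0 _)]; exact hGM _)
  have h1 : Integrable (fun ω => (W ω - w) * G (Z ω / h)) P :=
    (hGi.const_mul η).mono' ((hWm.sub_const w).mul hGZ).aestronglyMeasurable
      (ae_of_all _ fun ω => abs_mul_kernel_le hG0 hsupp hh hδ hW ω)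
  refine (h1.add (hGi.const_mul w)).congr (ae_of_all _ fun ω => ?_)
  simp only [Pi.add_apply]
  ring

/-- A kernel average of a variable `W` that tends to `w` as `Z` tends to zero is asymptotically
`w` times the corresponding average of the constant `1`. -/
theorem tendsto_integral_mul_kernel_div {Z W : Ω → ℝ} (hZ : Measurable Z) (hWm : Measurable W)
    {G : ℝ → ℝ} (hGm : Measurable G) (hG0 : ∀ t, 0 ≤ G t) {M : ℝ} (hGM : ∀ t, G t ≤ M)
    (hsupp : ∀ t, t ∉ Set.Icc (0 : ℝ) 1 → G t = 0) {w g : ℝ}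
    (hW : ∀ η > 0, ∃ δ > 0, ∀ ω, Z ω < δ → |W ω - w| ≤ η) {F : ℝ → ℝ} (hF : ∀ t, 0 ≤ F t)
    (hlim : Tendsto (fun h => (∫ ω, G (Z ω / h) ∂P) / F h) (𝓝[>] 0) (𝓝 g)) :
    Tendsto (fun h => (∫ ω, W ω * G (Z ω / h) ∂P) / F h) (𝓝[>] 0) (𝓝 (w * g)) := by
  have hdiff : Tendsto (fun h => (∫ ω, W ω * G (Z ω / h) ∂P) / F h -
      w * ((∫ ω, G (Z ω / h) ∂P) / F h)) (𝓝[>] 0) (𝓝 0) := by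
    rw [tendsto_zero_iff_abs_tendsto_zero]
    refine tendsto_zero_of_forall_le_mul_add (Eventually.of_forall fun h => abs_nonneg _) hlim
      fun η hη => ⟨fun _ => 0, tendsto_const_nhds, ?_⟩
    obtain ⟨δ, hδ, hWδ⟩ := hW η hη
    filter_upwards [Ioo_mem_nhdsGT hδ] with h hh
    have hGZ : Measurable fun ω => G (Z ω / h) := hGm.comp (hZ.div_const h)
    have hGi : Integrable (fun ω => G (Z ω / h)) P :=
      Integrable.of_bound hGZ.aestronglyMeasurable M (ae_of_all _ fun ω => by
        rw [Real.norm_eq_abs, abs_of_nonneg (hG0 _)]; exact hGM _)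
    have hWi : Integrable (fun ω => W ω * G (Z ω / h)) P :=
      integrable_mul_kernel hZ hWm hGm hG0 hGM hsupp hh.1 hh.2 hWδ
    have heq : (∫ ω, W ω * G (Z ω / h) ∂P) / F h - w * ((∫ ω, G (Z ω / h) ∂P) / F h) =
        (∫ ω, (W ω - w) * G (Z ω / h) ∂P) / F h := by
      simp only [sub_mul]
      rw [integral_sub hWi (hGi.const_mul w), integral_const_mul]
      ring
    simp only [Function.comp_apply]
    rw [heq, abs_div, abs_of_nonneg (hF h), add_zero, ← mul_div_assoc, ← integral_const_mul]
    refine div_le_div_of_nonneg_right ?_ (hF h)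
    rw [← Real.norm_eq_abs]
    refine norm_integral_le_of_norm_le (hGi.const_mul η) (ae_of_all _ fun ω => ?_)
    rw [Real.norm_eq_abs]
    exact abs_mul_kernel_le hG0 hsupp hh.1 hh.2 hWδ ω
  have := hdiff.add (hlim.const_mul w)
  simpa using this

/-- The normalized mass of a kernel bounded below on `[0, 1]` has the same lower bound. -/
lemma le_of_tendsto_integral_kernel_div {Z : Ω → ℝ} (hZ : Measurable Z) (hZ0 : ∀ ω, 0 ≤ Z ω)
    {G : ℝ → ℝ} (hGm : Measurable G) (hG0 : ∀ t, 0 ≤ G t) {M : ℝ} (hGM : ∀ t, G t ≤ M) {k : ℝ}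
    (hk : ∀ t ∈ Set.Icc (0 : ℝ) 1, k ≤ G t) (hpos : ∀ t, 0 < t → 0 < cdf (P.map Z) t) {g : ℝ}
    (hlim : Tendsto (fun h => (∫ ω, G (Z ω / h) ∂P) / cdf (P.map Z) h) (𝓝[>] 0) (𝓝 g)) :
    k ≤ g := by
  have := Measure.isProbabilityMeasure_map (μ := P) hZ.aemeasurable
  refine ge_of_tendsto hlim ?_
  filter_upwards [self_mem_nhdsWithin] with h hh
  have hh' : 0 < h := hh
  rw [le_div_iff₀ (hpos h hh), cdf_eq_real, map_measureReal_apply hZ measurableSet_Iic]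
  have hm : MeasurableSet (Z ⁻¹' Set.Iic h) := hZ measurableSet_Iic
  rw [mul_comm, ← smul_eq_mul, ← integral_indicator_const k hm]
  have hGi : Integrable (fun ω => G (Z ω / h)) P :=
    Integrable.of_bound (hGm.comp (hZ.div_const h)).aestronglyMeasurable M
      (ae_of_all _ fun ω => by rw [Real.norm_eq_abs, abs_of_nonneg (hG0 _)]; exact hGM _)
  refine integral_mono ((integrable_const k).indicator hm) hGi fun ω => ?_
  by_cases hω : Z ω ≤ h
  · simp only [Set.indicator_of_mem (show ω ∈ Z ⁻¹' Set.Iic h from hω)]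
    exact hk _ ⟨div_nonneg (hZ0 ω) hh'.le, (div_le_one hh').2 hω⟩
  · simp only [Set.indicator_of_notMem (show ω ∉ Z ⁻¹' Set.Iic h from hω)]
    exact hG0 _

end LocalAverage

/-- A conditional expectation may be substituted in the integral against a bounded variable that is
measurable for the conditioning. -/
lemma integral_mul_eq_of_condExp {Ω : Type*} {m m₀ : MeasurableSpace Ω} {P : Measure Ω}
    [IsProbabilityMeasure P] (hm : m ≤ m₀) {f f' g : Ω → ℝ} (hf : Integrable f P)
    (hg : Measurable[m] g) {C : ℝ} (hC : ∀ ω, |g ω| ≤ C) (hcond : P[f | m] =ᵐ[P] f') :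
    ∫ ω, f ω * g ω ∂P = ∫ ω, f' ω * g ω ∂P := by
  have hfg : Integrable (f * g) P :=
    hf.mul_bdd (c := C) (hg.mono hm le_rfl).aestronglyMeasurable (ae_of_all _ hC)
  have h1 := condExp_mul_of_stronglyMeasurable_right hg.stronglyMeasurable hfg hf
  calc ∫ ω, f ω * g ω ∂P = ∫ ω, (P[f * g | m]) ω ∂P := (integral_condExp hm).symm
    _ = _ := integral_congr_ae (h1.trans (hcond.mul (ae_eq_refl g)))

lemma SeminormContinuousNear.seminormContinuousAt {E : Type*} [AddCommGroup E] [Module ℝ E]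
    {p : Seminorm ℝ E} {f : E → ℝ} {χ : E} (hf : SeminormContinuousNear p f χ) :
    SeminormContinuousAt p f χ := by
  obtain ⟨ρ, hρ, H⟩ := hf
  exact H χ (by simpa using hρ)

namespace IsKernel

variable {K : ℝ → ℝ}

lemma measurable (hK : IsKernel K) : Measurable K := by
  have := hK.absolutelyContinuous.continuousOn
  rw [Set.uIcc_of_le zero_le_one] at this
  exact measurable_of_continuousOn_Icc this hK.support

lemma absolutelyContinuous_sq (hK : IsKernel K) :
    AbsolutelyContinuousOnInterval (fun u => K u ^ 2) 0 1 := by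
  simpa only [sq] using hK.absolutelyContinuous.fun_mul hK.absolutelyContinuous

lemma absolutelyContinuous_id_mul (hK : IsKernel K) :
    AbsolutelyContinuousOnInterval (fun u => u * K u) 0 1 :=
  ((LipschitzWith.id (α := ℝ)).lipschitzOnWith.absolutelyContinuousOnInterval).fun_mul
    hK.absolutelyContinuous

end IsKernel

/-! ### Kernel moments in the regression model -/

section Residual

variable {Ω E : Type*} [MeasurableSpace Ω] {P : Measure Ω} [IsProbabilityMeasure P]
  [MeasurableSpace E] {X : Ω → E} {Y : Ω → ℝ} {r σsq : E → ℝ}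

/-- The residual integrates to zero against bounded functions of the covariate. -/
lemma IsRegressionModel.integral_error_mul (hmodel : IsRegressionModel P X Y r σsq) {g : E → ℝ}
    (hg : Measurable g) {C : ℝ} (hC : ∀ x, |g x| ≤ C) :
    ∫ ω, (Y ω - r (X ω)) * g (X ω) ∂P = 0 := by
  have := integral_mul_eq_of_condExp hmodel.measurable_X.comap_le hmodel.integrable_error
    (hg.comp (comap_measurable X)) (fun ω => hC (X ω)) hmodel.condExp_error
  simpa using this

lemma IsRegressionModel.integral_error_sq_mul (hmodel : IsRegressionModel P X Y r σsq) {g : E → ℝ}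
    (hg : Measurable g) {C : ℝ} (hC : ∀ x, |g x| ≤ C) :
    ∫ ω, (Y ω - r (X ω)) ^ 2 * g (X ω) ∂P = ∫ ω, σsq (X ω) * g (X ω) ∂P :=
  integral_mul_eq_of_condExp hmodel.measurable_X.comap_le hmodel.integrable_error_sq
    (hg.comp (comap_measurable X)) (fun ω => hC (X ω)) hmodel.condExp_error_sq

end Residual

section Model

variable {Ω E : Type*} [MeasurableSpace Ω] {P : Measure Ω} [IsProbabilityMeasure P]
  [AddCommGroup E] [Module ℝ E] [MeasurableSpace E] {p : Seminorm ℝ E} {χ : E}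
  {X : Ω → E} {Y : Ω → ℝ} {r σsq : E → ℝ} {K : ℝ → ℝ}

/-- The mean of the centred response in a small ball only involves the radial bias. -/
lemma integral_response_mul_kernel (hp : Measurable fun x : E => p (χ - x))
    (hmodel : IsRegressionModel P X Y r σsq) (hY : Integrable Y P) {φ : ℝ → ℝ}
    (hφ : IsRadialBias P p χ X r φ) (hK : IsKernel K) (h : ℝ) :
    ∫ ω, (Y ω - r χ) * K (p (χ - X ω) / h) ∂P =
      ∫ ω, φ (p (χ - X ω)) * K (p (χ - X ω) / h) ∂P ∧
    ∫ ω, (r (X ω) - r χ) * K (p (χ - X ω) / h) ∂P =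
      ∫ ω, φ (p (χ - X ω)) * K (p (χ - X ω) / h) ∂P := by
  obtain ⟨M, hM⟩ := hK.bounded
  have hKabs : ∀ t, |K t| ≤ M := fun t => by rw [abs_of_nonneg (hK.nonneg t)]; exact hM t
  have hZ : Measurable fun ω => p (χ - X ω) := hp.comp hmodel.measurable_X
  have hri : Integrable (fun ω => r (X ω) - r χ) P := by
    refine ((hY.sub hmodel.integrable_error).sub (integrable_const (r χ))).congr
      (ae_of_all _ fun ω => ?_)
    simp
  have hKE : Measurable fun x => K (p (χ - x) / h) := hK.measurable.comp (hp.div_const h)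
  have h2 : ∫ ω, (r (X ω) - r χ) * K (p (χ - X ω) / h) ∂P =
      ∫ ω, φ (p (χ - X ω)) * K (p (χ - X ω) / h) ∂P := by
    have hcond := hφ.condExp_eq
    have hrev' : ∀ ω, p (X ω - χ) = p (χ - X ω) := fun ω => map_sub_rev p _ _
    simp only [hrev'] at hcond
    exact integral_mul_eq_of_condExp hZ.comap_le hri
      (hK.measurable.comp ((comap_measurable _).div_const h)) (fun ω => hKabs _) hcond
  refine ⟨?_, h2⟩
  rw [← h2]
  have h3 := hmodel.integral_error_mul hKE fun x => hKabs _
  have hKm : AEStronglyMeasurable (fun ω => K (p (χ - X ω) / h)) P :=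
    (hKE.comp hmodel.measurable_X).aestronglyMeasurable
  have hi1 : Integrable (fun ω => (Y ω - r (X ω)) * K (p (χ - X ω) / h)) P :=
    hmodel.integrable_error.mul_bdd hKm (ae_of_all _ fun ω => hKabs _)
  have hi2 : Integrable (fun ω => (r (X ω) - r χ) * K (p (χ - X ω) / h)) P :=
    hri.mul_bdd hKm (ae_of_all _ fun ω => hKabs _)
  have h4 := integral_add hi1 hi2
  rw [h3, zero_add] at h4
  rw [← h4]
  congr 1
  ext ω
  ring

/-- The second moment of the centred response in a small ball splits into a conditional variance
and a squared bias. -/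
lemma integral_response_sq_mul_kernel_sq (hp : Measurable fun x : E => p (χ - x))
    (hmodel : IsRegressionModel P X Y r σsq) (hK : IsKernel K) {δ h : ℝ} (hh : 0 < h) (hδ : h < δ)
    (hr : ∀ x, p (χ - x) < δ → |r x - r χ| ≤ 1) :
    ∫ ω, ((Y ω - r χ) * K (p (χ - X ω) / h)) ^ 2 ∂P =
      ∫ ω, σsq (X ω) * K (p (χ - X ω) / h) ^ 2 ∂P +
      ∫ ω, (r (X ω) - r χ) ^ 2 * K (p (χ - X ω) / h) ^ 2 ∂P := by
  obtain ⟨M, hM⟩ := hK.bounded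
  have hKsq0 : ∀ t, 0 ≤ K t ^ 2 := fun t => sq_nonneg _
  have hKsqM : ∀ t, K t ^ 2 ≤ M ^ 2 := fun t => pow_le_pow_left₀ (hK.nonneg t) (hM t) 2
  have hsupp : ∀ t, t ∉ Set.Icc (0 : ℝ) 1 → K t ^ 2 = 0 := fun t ht => by rw [hK.support t ht]; simp
  have hKE : Measurable fun x => K (p (χ - x) / h) ^ 2 :=
    (hK.measurable.comp (hp.div_const h)).pow_const 2
  have hrE : Measurable fun x => r x - r χ := hmodel.measurable_r.sub_const _
  have hKabs : ∀ x, |K (p (χ - x) / h) ^ 2| ≤ M ^ 2 := fun x => by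
    rw [abs_of_nonneg (hKsq0 _)]; exact hKsqM _
  have hbias : ∀ x, |(r x - r χ) * K (p (χ - x) / h) ^ 2| ≤ M ^ 2 := fun x => by
    have := abs_mul_kernel_le (Z := fun x => p (χ - x)) hKsq0 hsupp hh hδ hr x
    rw [one_mul] at this
    exact this.trans (hKsqM _)
  have hi1 : Integrable (fun ω => (Y ω - r (X ω)) ^ 2 * K (p (χ - X ω) / h) ^ 2) P :=
    hmodel.integrable_error_sq.mul_bdd (hKE.comp hmodel.measurable_X).aestronglyMeasurable
      (ae_of_all _ fun ω => hKabs (X ω))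
  have hi2 : Integrable
      (fun ω => (Y ω - r (X ω)) * ((r (X ω) - r χ) * K (p (χ - X ω) / h) ^ 2)) P :=
    hmodel.integrable_error.mul_bdd
      ((hrE.mul hKE).comp hmodel.measurable_X).aestronglyMeasurable
      (ae_of_all _ fun ω => hbias (X ω))
  have hi3 : Integrable (fun ω => (r (X ω) - r χ) ^ 2 * K (p (χ - X ω) / h) ^ 2) P := by
    refine integrable_mul_kernel (Z := fun ω => p (χ - X ω)) (W := fun ω => (r (X ω) - r χ) ^ 2)
      (hp.comp hmodel.measurable_X) ((hrE.comp hmodel.measurable_X).pow_const 2)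
      (hK.measurable.pow_const 2) hKsq0 hKsqM hsupp (w := 0) (η := 1) hh hδ fun ω hω => ?_
    rw [sub_zero, abs_of_nonneg (sq_nonneg _), ← sq_abs]
    exact pow_le_one₀ (abs_nonneg _) (hr _ hω)
  have h1 := hmodel.integral_error_sq_mul hKE hKabs
  have h2 := hmodel.integral_error_mul (hrE.mul hKE) hbias
  simp only [Pi.mul_apply] at h2
  rw [← h1]
  have h3 := integral_add (hi1.add (hi2.const_mul 2)) hi3
  have h4 := integral_add hi1 (hi2.const_mul 2)
  rw [integral_const_mul, h2, mul_zero, add_zero] at h4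
  simp only [Pi.add_apply] at h3 h4
  rw [h4] at h3
  rw [← h3]
  congr 1
  ext ω
  ring

/-- The first kernel moment of the centred response is `φ' M₀` times `h F(h)`, to the first order:
by continuity of the regression function `φ` vanishes at zero, so that `φ t` is `φ' t` up to a
negligible error. -/
theorem tendsto_integral_response_mul_kernel_div (hp : Measurable fun x : E => p (χ - x))
    (hmodel : IsRegressionModel P X Y r σsq) (hY : Integrable Y P)
    (hr : SeminormContinuousNear p r χ) {φ : ℝ → ℝ} {φ' : ℝ} (hφ : IsRadialBias P p χ X r φ)
    (hφ' : HasDerivWithinAt φ φ' (Set.Ici 0) 0) (hK : IsKernel K) {F : ℝ → ℝ} (hF : ∀ t, 0 ≤ F t)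
    {M₀ M₁ : ℝ} (hM₁ : M₁ ≠ 0)
    (hlim₀ : Tendsto (fun h => (∫ ω, p (χ - X ω) / h * K (p (χ - X ω) / h) ∂P) / F h) (𝓝[>] 0)
      (𝓝 M₀))
    (hlim₁ : Tendsto (fun h => (∫ ω, K (p (χ - X ω) / h) ∂P) / F h) (𝓝[>] 0) (𝓝 M₁)) :
    Tendsto (fun h => (∫ ω, (Y ω - r χ) * K (p (χ - X ω) / h) ∂P) / (h * F h)) (𝓝[>] 0)
      (𝓝 (φ' * M₀)) := by
  obtain ⟨M, hM⟩ := hK.bounded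
  have hZ : Measurable fun ω => p (χ - X ω) := hp.comp hmodel.measurable_X
  have hmoments := integral_response_mul_kernel hp hmodel hY hφ hK
  -- the radial bias vanishes at zero
  have hφ0 : φ 0 = 0 := by
    have h1 := tendsto_integral_mul_kernel_div (W := fun ω => r (X ω) - r χ) (w := 0) hZ
      ((hmodel.measurable_r.comp hmodel.measurable_X).sub_const _) hK.measurable hK.nonneg hM
      hK.support (fun η hη => ?_) hF hlim₁
    · have h2 := tendsto_integral_mul_kernel_div (W := fun ω => φ (p (χ - X ω))) (w := φ 0) hZ
        (hφ.measurable.comp hZ) hK.measurable hK.nonneg hM hK.support (fun η hη => ?_) hF hlim₁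
      · simp only [(hmoments _).2] at h1
        have h3 := tendsto_nhds_unique h1 h2
        rw [zero_mul, eq_comm] at h3
        exact (mul_eq_zero.1 h3).resolve_right hM₁
      · obtain ⟨δ, hδ, H⟩ := Metric.continuousWithinAt_iff.1 hφ'.continuousWithinAt η hη
        refine ⟨δ, hδ, fun ω hω => ?_⟩
        have hnn : 0 ≤ p (χ - X ω) := apply_nonneg p _
        have := H hnn (by rwa [Real.dist_eq, sub_zero, abs_of_nonneg hnn])
        rw [Real.dist_eq] at this
        exact this.le
    · obtain ⟨δ, hδ, H⟩ := hr.seminormContinuousAt η hη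
      refine ⟨δ, hδ, fun ω hω => ?_⟩
      rw [sub_zero]
      exact (H _ (by rwa [map_sub_rev])).le
  -- `φ t / t`, completed by its limit at zero
  set ψ : ℝ → ℝ := fun t => if t = 0 then φ' else φ t / t with hψ
  have hψm : Measurable ψ :=
    Measurable.ite (measurableSet_singleton 0) measurable_const (hφ.measurable.div measurable_id)
  have hidK0 : ∀ t, 0 ≤ t * K t := fun t => by
    by_cases ht : t ∈ Set.Icc (0 : ℝ) 1
    · exact mul_nonneg ht.1 (hK.nonneg t)
    · rw [hK.support t ht, mul_zero]
  have hidKM : ∀ t, t * K t ≤ M := fun t => by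
    by_cases ht : t ∈ Set.Icc (0 : ℝ) 1
    · exact (mul_le_of_le_one_left (hK.nonneg t) ht.2).trans (hM t)
    · rw [hK.support t ht, mul_zero]
      exact (hK.nonneg 0).trans (hM 0)
  have hmain := tendsto_integral_mul_kernel_div (W := fun ω => ψ (p (χ - X ω))) (w := φ') hZ
    (hψm.comp hZ) (G := fun u => u * K u) (measurable_id.mul hK.measurable) hidK0 hidKM
    (fun t ht => by rw [hK.support t ht, mul_zero]) (fun η hη => ?_) hF hlim₀
  · refine hmain.congr' ?_
    filter_upwards [self_mem_nhdsWithin] with h hh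
    have hh' : (0 : ℝ) < h := hh
    rw [(hmoments h).1, ← div_div]
    congr 1
    rw [← integral_div]
    congr 1
    ext ω
    by_cases h0 : p (χ - X ω) = 0
    · simp [h0, hφ0]
    · simp only [hψ, h0, if_false]
      field_simp
  · have hslope := hasDerivWithinAt_iff_tendsto_slope.1 hφ'
    obtain ⟨δ, hδ, H⟩ := Metric.mem_nhdsWithin_iff.1 (hslope (Metric.closedBall_mem_nhds φ' hη))
    refine ⟨δ, hδ, fun ω hω => ?_⟩
    have hnn : 0 ≤ p (χ - X ω) := apply_nonneg p _
    by_cases h0 : p (χ - X ω) = 0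
    · simp [hψ, h0, hη.le]
    · have := H ⟨by rwa [Metric.mem_ball, Real.dist_eq, sub_zero, abs_of_nonneg hnn], hnn, h0⟩
      have h1 : slope φ 0 (p (χ - X ω)) ∈ Metric.closedBall φ' η := this
      rw [Metric.mem_closedBall, Real.dist_eq, slope_def_field, hφ0, sub_zero, sub_zero] at h1
      simpa only [hψ, h0, if_false] using h1

/-- The second kernel moment of the centred response is `σ²(χ) M₂` times `F(h)`, to the first
order, and `σ²(χ)` is nonnegative. -/
theorem tendsto_integral_response_sq_mul_kernel_div (hp : Measurable fun x : E => p (χ - x))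
    (hmodel : IsRegressionModel P X Y r σsq)
    (hr : SeminormContinuousNear p r χ) (hσ : SeminormContinuousNear p σsq χ) (hK : IsKernel K)
    {F : ℝ → ℝ} (hF : ∀ t, 0 ≤ F t) {M₂ : ℝ} (hM₂ : 0 < M₂)
    (hlim₂ : Tendsto (fun h => (∫ ω, K (p (χ - X ω) / h) ^ 2 ∂P) / F h) (𝓝[>] 0) (𝓝 M₂)) :
    Tendsto (fun h => (∫ ω, ((Y ω - r χ) * K (p (χ - X ω) / h)) ^ 2 ∂P) / F h) (𝓝[>] 0)
      (𝓝 (σsq χ * M₂)) ∧ 0 ≤ σsq χ := by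
  obtain ⟨M, hM⟩ := hK.bounded
  have hZ : Measurable fun ω => p (χ - X ω) := hp.comp hmodel.measurable_X
  have hKsq0 : ∀ t, 0 ≤ K t ^ 2 := fun t => sq_nonneg _
  have hKsqM : ∀ t, K t ^ 2 ≤ M ^ 2 := fun t => pow_le_pow_left₀ (hK.nonneg t) (hM t) 2
  have hsupp : ∀ t, t ∉ Set.Icc (0 : ℝ) 1 → K t ^ 2 = 0 := fun t ht => by rw [hK.support t ht]; simp
  have hvar := tendsto_integral_mul_kernel_div (W := fun ω => σsq (X ω)) (w := σsq χ) hZ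
    (hmodel.measurable_σsq.comp hmodel.measurable_X) (G := fun u => K u ^ 2)
    (hK.measurable.pow_const 2) hKsq0 hKsqM hsupp (fun η hη => by
      obtain ⟨δ, hδ, H⟩ := hσ.seminormContinuousAt η hη
      exact ⟨δ, hδ, fun ω hω => (H _ (by rwa [map_sub_rev])).le⟩) hF hlim₂
  have hbias := tendsto_integral_mul_kernel_div (W := fun ω => (r (X ω) - r χ) ^ 2) (w := 0) hZ
    (((hmodel.measurable_r.comp hmodel.measurable_X).sub_const _).pow_const 2)
    (G := fun u => K u ^ 2) (hK.measurable.pow_const 2) hKsq0 hKsqM hsupp (fun η hη => by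
      obtain ⟨δ, hδ, H⟩ := hr.seminormContinuousAt (√η) (Real.sqrt_pos.2 hη)
      refine ⟨δ, hδ, fun ω hω => ?_⟩
      have h1 := (H (X ω) (by rwa [map_sub_rev])).le
      rw [sub_zero, abs_of_nonneg (sq_nonneg _), ← sq_abs, ← Real.sq_sqrt hη.le]
      exact pow_le_pow_left₀ (abs_nonneg _) h1 2) hF hlim₂
  refine ⟨?_, ?_⟩
  · have hsum := hvar.add hbias
    rw [zero_mul, add_zero] at hsum
    refine hsum.congr' ?_
    obtain ⟨δ, hδ, H⟩ := hr.seminormContinuousAt 1 one_pos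
    filter_upwards [Ioo_mem_nhdsGT hδ] with h hh
    rw [integral_response_sq_mul_kernel_sq hp hmodel hK hh.1 hh.2
      (fun x hx => (H x (by rwa [map_sub_rev])).le), add_div]
  · have h1 : 0 ≤ σsq χ * M₂ := by
      refine ge_of_tendsto hvar (Eventually.of_forall fun h => div_nonneg ?_ (hF h))
      rw [← hmodel.integral_error_sq_mul (g := fun x => K (p (χ - x) / h) ^ 2)
        ((hK.measurable.comp (hp.div_const h)).pow_const 2) (C := M ^ 2)
        (fun x => by rw [abs_of_nonneg (hKsq0 _)]; exact hKsqM _)]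
      exact integral_nonneg fun ω => mul_nonneg (sq_nonneg _) (sq_nonneg _)
    exact nonneg_of_mul_nonneg_left h1 hM₂

end Model

/-! ### Asymptotic normality -/

theorem theorem3 {Ω E : Type*} [MeasurableSpace Ω] (P : Measure Ω) [IsProbabilityMeasure P]
    [NormedAddCommGroup E] [NormedSpace ℝ E] [CompleteSpace E] [MeasurableSpace E]
    (p : Seminorm ℝ E) (χ : E) (hp : Measurable fun x : E => p (χ - x))
    -- the pair `(X, Y)`, the regression model and the sample
    (X : Ω → E) (Y : Ω → ℝ) (r σsq : E → ℝ) (hmodel : IsRegressionModel P X Y r σsq)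
    (Xs : ℕ → Ω → E) (Ys : ℕ → Ω → ℝ)
    (hindep : iIndepFun (fun (i : ℕ) ω => (Xs (i + 1) ω, Ys (i + 1) ω)) P)
    (hident : ∀ i, 1 ≤ i →
      IdentDistrib (fun ω => (Xs i ω, Ys i ω)) (fun ω => (X ω, Y ω)) P P)
    -- the kernel, the bandwidths, the parameter and the distribution function of `‖χ - X‖`
    (K : ℝ → ℝ) (h : ℕ → ℝ) (ℓ : ℝ) (hℓ : ℓ ∈ Set.Icc (0 : ℝ) 1)
    (hh : ∀ n, 1 ≤ n → 0 < h n)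
    (F : ℝ → ℝ) (hF : F = smallBall P p χ X)
    -- continuity of `r`, `σ²`; `F(0) = 0`; differentiability of `φ` at `0`
    (hr : SeminormContinuousNear p r χ) (hσ : SeminormContinuousNear p σsq χ) (hF0 : F 0 = 0)
    (φ : ℝ → ℝ) (φ' : ℝ) (hφ : IsRadialBias P p χ X r φ)
    (hφ' : HasDerivWithinAt φ φ' (Set.Ici 0) 0)
    -- the kernel
    (hK : IsKernel K)
    -- the limit `τ₀`
    (τ₀ : ℝ → ℝ)
    (hτ : ∀ s ∈ Set.Icc (0 : ℝ) 1, Tendsto (fun t => F (t * s) / F t) (𝓝[>] 0) (𝓝 (τ₀ s)))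
    -- the bandwidths
    (hh0 : Tendsto h atTop (𝓝 0))
    (hnF : Tendsto (fun n : ℕ => (n : ℝ) * F (h n)) atTop atTop)
    (α : ℝ) (hα : Tendsto (bandwidthA F h ℓ) atTop (𝓝 α))
    (β : ℝ → ℝ) (hβ : ∀ q : ℝ, q ≤ 2 → Tendsto (bandwidthB F h q) atTop (𝓝 (β q)))
    -- exponential moment of the response
    (hexp : ∃ a b : ℝ, 0 < a ∧ 0 < b ∧ Integrable (fun ω => Real.exp (a * |Y ω| ^ b)) P)
    -- `n F(h_n)` dominates every power of `ln n`
    (hlog : ∀ δ : ℝ, 0 < δ → Tendsto (fun n : ℕ => Real.log n ^ δ / √((n : ℝ) * F (h n)))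
      atTop (𝓝 0))
    (c : ℝ) (hc : 0 ≤ c)
    (hlim : Tendsto (fun n : ℕ => h n * √((n : ℝ) * F (h n))) atTop (𝓝 c)) :
    0 < β (1 - ℓ) ∧ 0 < kernelM1 K τ₀ ∧
    0 ≤ β (1 - 2 * ℓ) / β (1 - ℓ) ^ 2 * (kernelM2 K τ₀ / kernelM1 K τ₀ ^ 2) * σsq χ ∧
    TendstoInDistribution
      (fun (n : ℕ) (ω : Ω) =>
        √((n : ℝ) * F (h n)) * (recursiveEstimator p χ K h F ℓ Xs Ys n ω - r χ))
      atTop (id : ℝ → ℝ) (fun _ => P)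
      (gaussianReal
        (c * (α / β (1 - ℓ)) * (kernelM0 K τ₀ / kernelM1 K τ₀) * φ')
        (Real.toNNReal
          (β (1 - 2 * ℓ) / β (1 - ℓ) ^ 2 * (kernelM2 K τ₀ / kernelM1 K τ₀ ^ 2) * σsq χ))) := by
  obtain ⟨M, hM⟩ := hK.bounded
  obtain ⟨k, hk0, hk⟩ := hK.pos
  set Z : Ω → ℝ := fun ω => p (χ - X ω) with hZdef
  set U : Ω → ℝ := fun ω => Y ω - r χ with hUdef
  set Zs : ℕ → Ω → ℝ := fun i ω => p (χ - Xs (i + 1) ω) with hZsdef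
  set Us : ℕ → Ω → ℝ := fun i ω => Ys (i + 1) ω - r χ with hUsdef
  have hZ : Measurable Z := hp.comp hmodel.measurable_X
  have hZ0 : ∀ ω, 0 ≤ Z ω := fun ω => apply_nonneg p _
  have hU : Measurable U := hmodel.measurable_Y.sub_const _
  have hFcdf : ∀ t, F t = cdf (P.map Z) t := fun t => by rw [hF]; rfl
  have hFnonneg : ∀ t, 0 ≤ F t := fun t => by rw [hFcdf]; exact cdf_nonneg _ _
  have hFle : ∀ t, F t ≤ 1 := fun t => by rw [hFcdf]; exact cdf_le_one _ _
  have hFmono : Monotone F := fun s t hst => by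
    rw [hFcdf, hFcdf]; exact monotone_cdf _ hst
  -- every ball around `χ` is charged, since `n F(h n)` is eventually positive
  have hFpos : ∀ t, 0 < t → 0 < F t := by
    intro t ht
    obtain ⟨n, h1, h2, h3⟩ := ((hh0.eventually_lt_const ht).and
      ((hnF.eventually_gt_atTop 0).and (eventually_ge_atTop 1))).exists
    have h4 : 0 < F (h n) := by
      have : (0 : ℝ) < n := by exact_mod_cast h3
      exact (pos_iff_pos_of_mul_pos h2).1 this
    exact h4.trans_le (hFmono h1.le)
  have hpos : ∀ n, 1 ≤ n → 0 < F (h n) := fun n hn => hFpos _ (hh n hn)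
  have hhgt : Tendsto h atTop (𝓝[>] 0) :=
    tendsto_nhdsWithin_iff.2 ⟨hh0, (eventually_ge_atTop 1).mono fun n hn => hh n hn⟩
  have hFh0 : Tendsto (fun n => F (h n)) atTop (𝓝 0) := by
    have hcont : ContinuousWithinAt F (Set.Ici 0) 0 := by
      have : F = cdf (P.map Z) := funext hFcdf
      rw [this]
      exact (cdf (P.map Z)).right_continuous 0
    have := hcont.tendsto.comp (tendsto_nhdsWithin_iff.2
      ⟨hh0, (eventually_ge_atTop 1).mono fun n hn => (hh n hn).le⟩)
    rwa [hF0] at this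
  have hcdfpos : ∀ t, 0 < t → 0 < cdf (P.map Z) t := fun t ht => by
    rw [← hFcdf]; exact hFpos t ht
  simp only [hFcdf] at hτ
  -- the three kernel moments
  have hlim₁ : Tendsto (fun h => (∫ ω, K (Z ω / h) ∂P) / cdf (P.map Z) h) (𝓝[>] 0)
      (𝓝 (kernelM1 K τ₀)) :=
    tendsto_integral_kernel_div hZ hZ0 hK.absolutelyContinuous hK.support hcdfpos hτ
  have hlim₂ : Tendsto (fun h => (∫ ω, K (Z ω / h) ^ 2 ∂P) / cdf (P.map Z) h) (𝓝[>] 0)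
      (𝓝 (kernelM2 K τ₀)) :=
    tendsto_integral_kernel_div hZ hZ0 hK.absolutelyContinuous_sq
      (fun t ht => by rw [hK.support t ht]; simp) hcdfpos hτ
  have hlim₀ : Tendsto (fun h => (∫ ω, Z ω / h * K (Z ω / h) ∂P) / cdf (P.map Z) h) (𝓝[>] 0)
      (𝓝 (kernelM0 K τ₀)) := by
    have := tendsto_integral_kernel_div hZ hZ0 hK.absolutelyContinuous_id_mul
      (fun t ht => by rw [hK.support t ht, mul_zero]) hcdfpos hτ
    simpa only [kernelM0, one_mul] using this
  have hM₁ : 0 < kernelM1 K τ₀ := hk0.trans_le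
    (le_of_tendsto_integral_kernel_div hZ hZ0 hK.measurable hK.nonneg hM hk hcdfpos hlim₁)
  have hM₂ : 0 < kernelM2 K τ₀ := (pow_pos hk0 2).trans_le
    (le_of_tendsto_integral_kernel_div hZ hZ0 (hK.measurable.pow_const 2) (fun t => sq_nonneg _)
      (fun t => pow_le_pow_left₀ (hK.nonneg t) (hM t) 2)
      (fun t ht => pow_le_pow_left₀ hk0.le (hk t ht) 2) hcdfpos hlim₂)
  simp only [← hFcdf] at hlim₀ hlim₁ hlim₂
  -- the moments of the response
  have hexpU := exists_integrable_exp_sub_const hmodel.measurable_Y (r χ) hexp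
  have hU2 : MemLp U 2 P := memLp_two_of_integrable_exp hU hexpU
  have hYint : Integrable Y P :=
    ((hU2.integrable (by norm_num)).add (integrable_const (r χ))).congr
      (ae_of_all _ fun ω => by simp [hUdef])
  have hb := tendsto_integral_response_mul_kernel_div hp hmodel hYint hr hφ hφ' hK hFnonneg
    hM₁.ne' hlim₀ hlim₁
  obtain ⟨hs, hσ0⟩ := tendsto_integral_response_sq_mul_kernel_div hp hmodel hr hσ hK hFnonneg
    hM₂ hlim₂
  obtain ⟨A, δ, C, hA, hδ, hC⟩ := exists_truncation_of_integrable_exp hU hexpU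
  -- the limits of the bandwidth means
  have hβ₁ : 0 < β (1 - ℓ) :=
    bandwidth_limit_pos hpos (hβ _ (by linarith [hℓ.1])) (hβ (-(1 - ℓ)) (by linarith [hℓ.2]))
  have hβ₂ : 0 ≤ β (1 - 2 * ℓ) := by
    refine ge_of_tendsto (hβ _ (by linarith [hℓ.1])) (Eventually.of_forall fun n => ?_)
    exact mul_nonneg (by positivity) (Finset.sum_nonneg fun i _ =>
      Real.rpow_nonneg (div_nonneg (hFnonneg _) (hFnonneg _)) _)
  have hvar : 0 ≤ β (1 - 2 * ℓ) / β (1 - ℓ) ^ 2 * (kernelM2 K τ₀ / kernelM1 K τ₀ ^ 2) * σsq χ := by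
    positivity
  refine ⟨hβ₁, hM₁, hvar, ?_⟩
  -- the sample of distances and centred responses
  have hpair : Measurable fun q : E × ℝ => (p (χ - q.1), q.2 - r χ) :=
    (hp.comp measurable_fst).prodMk (measurable_snd.sub_const _)
  have hid : ∀ i, IdentDistrib (fun ω => (Zs i ω, Us i ω)) (fun ω => (Z ω, U ω)) P P := fun i =>
    (hident (i + 1) (by omega)).comp hpair
  have hind : iIndepFun (fun (i : ℕ) ω => (Zs i ω, Us i ω)) P :=
    hindep.comp (fun _ q => (p (χ - q.1), q.2 - r χ)) fun _ => hpair
  have hZsm : ∀ i, AEMeasurable (Zs i) P := fun i => (hid i).aemeasurable_fst.fst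
  have hUsm : ∀ i, AEMeasurable (Us i) P := fun i => (hid i).aemeasurable_fst.snd
  have hKZs : ∀ i, AEMeasurable (fun ω => K (Zs i ω / h (i + 1))) P := fun i =>
    hK.measurable.comp_aemeasurable ((hZsm i).div_const _)
  have hnum := tendstoInDistribution_weighted_kernel_sum hind hid hU2 hK.measurable hK.nonneg hM hh
    hh0 hpos hFle hFh0 hnF hℓ.1 (hb.comp hhgt) (hs.comp hhgt) (L := fun n => A * Real.log n ^ δ)
    (fun n => by have := Real.log_natCast_nonneg n; positivity)
    (by simpa only [mul_div_assoc, mul_zero] using (hlog δ hδ).const_mul A) hC hα hβ hlim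
  have hden := tendstoInMeasure_weighted_kernel_sum (Z := Z) (Zs := Zs)
    (hind.comp (fun _ q => q.1) fun _ => measurable_fst) (fun i => (hid i).comp measurable_fst)
    hK.measurable hK.nonneg hM hpos hFle hnF hℓ.1 (hlim₁.comp hhgt) hβ
  have hest : ∀ n ω, recursiveEstimator p χ K h F ℓ Xs Ys n ω =
      (∑ i ∈ Finset.range n, (Us i ω + r χ) / F (h (i + 1)) ^ ℓ * K (Zs i ω / h (i + 1))) /
        ∑ i ∈ Finset.range n, 1 / F (h (i + 1)) ^ ℓ * K (Zs i ω / h (i + 1)) := by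
    intro n ω
    simp only [recursiveEstimator, sum_Icc_one_eq_sum_range, hUsdef, hZsdef, sub_add_cancel]
  have hquot := tendstoInDistribution_div_of_tendstoInMeasure
    (T := fun (n : ℕ) ω =>
      √((n : ℝ) * F (h n)) * (recursiveEstimator p χ K h F ℓ Xs Ys n ω - r χ))
    (mul_pos hβ₁ hM₁) hnum hden ?_ ?_ ?_
  · convert! hquot using 2
    · field_simp
    · rw [← Real.toNNReal_div' (sq_nonneg _)]
      congr 1
      field_simp
  · exact fun n => Finset.aemeasurable_fun_sum _ fun i _ => (hKZs i).const_mul _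
  · intro n
    simp only [hest]
    refine ((AEMeasurable.div ?_ ?_).sub_const _).const_mul _
    · exact Finset.aemeasurable_fun_sum _ fun i _ =>
        (((hUsm i).add_const _).div_const _).mul (hKZs i)
    · exact Finset.aemeasurable_fun_sum _ fun i _ => (hKZs i).const_mul _
  · filter_upwards [eventually_ge_atTop 1] with n hn ω hD
    have hFn := hpos n hn
    have hn0 : (0 : ℝ) < n := by exact_mod_cast hn
    have hρ : ∀ i, (F (h (i + 1)) / F (h n)) ^ (-ℓ) = F (h n) ^ ℓ * (1 / F (h (i + 1)) ^ ℓ) := by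
      intro i
      have := hpos (i + 1) (by omega)
      rw [Real.rpow_neg (by positivity), Real.div_rpow this.le hFn.le, inv_div, mul_one_div]
    -- the normalizations of numerator and denominator only differ by `√(n F(h n))`
    set W := ∑ i ∈ Finset.range n, 1 / F (h (i + 1)) ^ ℓ * K (Zs i ω / h (i + 1)) with hW
    set V := ∑ i ∈ Finset.range n, (Us i ω + r χ) / F (h (i + 1)) ^ ℓ * K (Zs i ω / h (i + 1))
      with hV
    have hDW : ∑ i ∈ Finset.range n, ((n : ℝ) * F (h n))⁻¹ *
        (F (h (i + 1)) / F (h n)) ^ (-ℓ) * K (Zs i ω / h (i + 1)) =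
        ((n : ℝ) * F (h n))⁻¹ * F (h n) ^ ℓ * W := by
      rw [hW, Finset.mul_sum]
      exact Finset.sum_congr rfl fun i _ => by rw [hρ]; ring
    have hSV : ∑ i ∈ Finset.range n, (√((n : ℝ) * F (h n)))⁻¹ *
        (F (h (i + 1)) / F (h n)) ^ (-ℓ) * (Us i ω * K (Zs i ω / h (i + 1))) =
        (√((n : ℝ) * F (h n)))⁻¹ * F (h n) ^ ℓ * (V - r χ * W) := by
      rw [hV, hW, Finset.mul_sum, ← Finset.sum_sub_distrib, Finset.mul_sum]
      exact Finset.sum_congr rfl fun i _ => by rw [hρ]; ring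
    have hD' : 0 < ((n : ℝ) * F (h n))⁻¹ * F (h n) ^ ℓ * W := by rwa [← hDW]
    have hFℓ : 0 < F (h n) ^ ℓ := Real.rpow_pos_of_pos hFn ℓ
    have hW0 : W ≠ 0 := fun h0 => by rw [h0, mul_zero] at hD'; exact lt_irrefl _ hD'
    have hsq : √((n : ℝ) * F (h n)) ^ 2 = n * F (h n) := Real.sq_sqrt (by positivity)
    have hsq0 : 0 < √((n : ℝ) * F (h n)) := Real.sqrt_pos.2 (by positivity)
    have hquotient : ∀ a b : ℝ, a ≠ 0 → a ^ 2 = b → a * (V / W - r χ) =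
        a⁻¹ * F (h n) ^ ℓ * (V - r χ * W) / (b⁻¹ * F (h n) ^ ℓ * W) := by
      rintro a _ ha rfl
      field_simp
    rw [hest, hSV, hDW]
    exact hquotient _ _ hsq0.ne' hsq
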